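/- **Conventions.** Cubes $Q\subset\mathbb{R}^n$ are half-open with sides parallel to the axes, $|Q|$ is Lebesgue measure and $b_Q=|Q|^{-1}\int_Q b$. $\mathcal{D}(Q)$ is the set of cubes obtained from $Q$ by repeated subdivision into $2^n$ congruent subcubes ($Q$ included). A *dyadic lattice* is a collection $\mathcal{D}$ of cubes such that (i) the $2^n$ children of each $Q\in\mathcal D$ lie in $\mathcal D$, (ii) any $Q_1,Q_2\in\mathcal{D}$ satisfy $Q_1,Q_2\in\mathcal{D}(Q)$ for some $Q\in\mathcal{D}$, (iii) every compact set is contained in some $Q\in\mathcal{D}$. A *sparse family* is a subset $\mathcal{S}$ of a dyadic lattice for which there are $\eta\in(0,1)$ and pairwise disjoint measurable sets $E_Q\subset Q$ ($Q\in\mathcal{S}$) with $|E_Q|\ge\eta|Q|$. A *weight* is a nonnegative locally integrable function on $\mathbb{R}^n$, and $\|g\|_{L^r(w)}=(\int|g|^r w\,dx)^{1/r}$. In products $0\cdot\infty=0$, and $\nu^{-1/p}=\infty$ where $\nu=0$. A *Young function* is an increasing convex $A:[0,\infty)\to[0,\infty)$ with $A(0)=0$ and $A(t)/t\to\infty$ as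 $t\to\infty$ (increasing in the non-strict sense); put $A(\infty)=\infty$, and let $\bar A(t)=\sup_{s>0}\{st-A(s)\}$. For $1<r<\infty$, $\Phi\in B_r$ means $\int_1^\infty \frac{\Phi(t)}{t^r}\frac{dt}{t}<\infty$, and $\Phi\in B_{p,q}$ means $\int_1^\infty\frac{\Phi(t)^{q/p}}{t^q}\frac{dt}{t}<\infty$. Write $$\|g\|_{A,Q}=\inf\Big\{\lambda>0:\ \frac1{|Q|}\int_QA\Big(\frac{|g|}{\lambda}\Big)dx\le1\Big\},\qquad \|g\|_{r,Q}=\Big(\frac1{|Q|}\int_Q|g|^r\,dx\Big)^{1/r}.$$ **Theorem.** Let $1<p\le q<\infty$, $p'=p/(p-1)$, $q'=q/(q-1)$, $0<\alpha<n$, let $m\ge1$ be an integer, $b\in L^m_{\rm loc}(\mathbb{R}^n)$ (real or complex valued), $\mathcal{S}$ a sparse family and $(\mu,\nu)$ a pair of weights. For measurable $f$ put $$T^{b,m}_{\mathcal{S},\alpha}f(x)=\sup_{Q\in\mathcal{S}}|Q|^{\alpha/n}\Big(\frac1{|Q|}\int_Q|b-b_Q|^m|f|\,dy\Big)\chi_Q(x),$$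 $$(T^{b,m}_{\mathcal{S},\alpha})^*f(x)=\sup_{Q\in\mathcal{S}}|Q|^{\alpha/n}|b(x)-b_Q|^m\Big(\frac1{|Q|}\int_Q|f|\,dy\Big)\chi_Q(x),$$ and let $\widetilde T^{b,m}_{\mathcal{S},\alpha}$, $(\widetilde T^{b,m}_{\mathcal{S},\alpha})^*$ be the operators given by the same formulas with $\sup_{Q\in\mathcal{S}}$ replaced by $\sum_{Q\in\mathcal{S}}$. Consider the statement that there is a constant $K<\infty$ such that for all measurable $f$ $$\|T^{b,m}_{\mathcal{S},\alpha}f\|_{L^q(\mu)}+\|(T^{b,m}_{\mathcal{S},\alpha})^*f\|_{L^q(\mu)}\le K\|f\|_{L^p(\nu)},\qquad(\ast)$$ and the corresponding statement $(\widetilde\ast)$ for $\widetilde T^{b,m}_{\mathcal{S},\alpha}$ and $(\widetilde T^{b,m}_{\mathcal{S},\alpha})^*$. (1) Suppose that $A,B,C,D$ are Young functions with $\bar A,\bar C\in B_{q'}$ and $\bar B,\bar D\in B_{p,q}$. If $$\sup_{Q\in\mathcal{S}}|Q|^{\frac\alpha n+\frac1q-\frac1p}\|\mu^{1/q}\|_{A,Q}\|(b-b_Q)^m\nu^{-1/p}\|_{B,Q}+\sup_{Q\in\mathcal{S}}|Q|^{\frac\alpha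 n+\frac1q-\frac1p}\|(b-b_Q)^m\mu^{1/q}\|_{C,Q}\|\nu^{-1/p}\|_{D,Q}<\infty,$$ then $(\ast)$ and $(\widetilde\ast)$ hold. (2) Conversely, if $(\ast)$ or $(\widetilde\ast)$ holds, then $$\sup_{Q\in\mathcal{S}}|Q|^{\frac\alpha n+\frac1q-\frac1p}\|\mu^{1/q}\|_{q,Q}\|(b-b_Q)^m\nu^{-1/p}\|_{p',Q}+\sup_{Q\in\mathcal{S}}|Q|^{\frac\alpha n+\frac1q-\frac1p}\|(b-b_Q)^m\mu^{1/q}\|_{q,Q}\|\nu^{-1/p}\|_{p',Q}<\infty.$$ -/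

import Mathlib

open MeasureTheory Set Filter
open scoped NNReal ENNReal

namespace SparseBump

noncomputable section

/-! Throughout, `ℝⁿ` is `Fin n → ℝ` with Lebesgue measure `volume`; no norm of `ℝⁿ` is used.
Nonnegative quantities live in `ℝ≥0∞`, with `0 * ∞ = 0` and `0 ^ (-s) = ∞` for `s > 0`. -/

/-- A (half-open) cube in `ℝⁿ` with sides parallel to the axes. -/
@[ext]
structure Cube (n : ℕ) where
  corner : Fin n → ℝ
  side : ℝ
  side_pos : 0 < side

/-- The set of points of a cube, `∏ [a_i, a_i + h)`. -/
def Cube.toSet {n : ℕ} (Q : Cube n) : Set (Fin n → ℝ) :=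
  Set.pi Set.univ fun i => Set.Ico (Q.corner i) (Q.corner i + Q.side)

/-- `R` is one of the `2 ^ n` congruent subcubes of `Q` of half the side length. -/
def IsChild {n : ℕ} (Q R : Cube n) : Prop :=
  R.side = Q.side / 2 ∧
    ∀ i, R.corner i = Q.corner i ∨ R.corner i = Q.corner i + Q.side / 2

/-- `𝓓(Q)`: the cubes obtained by repeatedly subdividing `Q` (including `Q` itself). -/
def descendants {n : ℕ} (Q : Cube n) : Set (Cube n) :=
  {R | Relation.ReflTransGen IsChild Q R}

/-- Dyadic lattices of cubes. -/
structure IsDyadicLattice {n : ℕ} (D : Set (Cube n)) : Prop where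
  child_mem : ∀ Q ∈ D, ∀ R, IsChild Q R → R ∈ D
  common_ancestor : ∀ Q₁ ∈ D, ∀ Q₂ ∈ D, ∃ Q ∈ D, Q₁ ∈ descendants Q ∧ Q₂ ∈ descendants Q
  exhausts : ∀ K : Set (Fin n → ℝ), IsCompact K → ∃ Q ∈ D, K ⊆ Q.toSet

/-- `S` is `η`-sparse: there are pairwise disjoint measurable `E_Q ⊆ Q` with `η |Q| ≤ |E_Q|`. -/
def IsEtaSparse {n : ℕ} (η : ℝ) (S : Set (Cube n)) : Prop :=
  ∃ E : Cube n → Set (Fin n → ℝ),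
    (∀ Q ∈ S, MeasurableSet (E Q) ∧ E Q ⊆ Q.toSet ∧
      ENNReal.ofReal η * volume Q.toSet ≤ volume (E Q)) ∧
    S.PairwiseDisjoint E

/-- A sparse family: an `η`-sparse subfamily of a dyadic lattice, for some `η ∈ (0, 1)`. -/
def IsSparse {n : ℕ} (S : Set (Cube n)) : Prop :=
  ∃ D : Set (Cube n), IsDyadicLattice D ∧ S ⊆ D ∧ ∃ η : ℝ, 0 < η ∧ η < 1 ∧ IsEtaSparse η S

/-- Weights: nonnegative locally integrable functions on `ℝⁿ`. -/
structure IsWeight {n : ℕ} (w : (Fin n → ℝ) → ℝ) : Prop where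
  nonneg : ∀ x, 0 ≤ w x
  locallyIntegrable : LocallyIntegrable w volume

/-- `b ∈ L^m_loc(ℝⁿ)`. -/
def MemLmLoc {n : ℕ} {𝕜 : Type*} [RCLike 𝕜] (m : ℕ) (b : (Fin n → ℝ) → 𝕜) : Prop :=
  ∀ K : Set (Fin n → ℝ), IsCompact K → MemLp b (m : ℝ≥0∞) (volume.restrict K)

/-- Young functions `A : [0, ∞) → [0, ∞)`. -/
structure IsYoung (A : ℝ≥0 → ℝ≥0) : Prop where
  monotone : Monotone A
  convex : ConvexOn ℝ≥0 Set.univ A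
  map_zero : A 0 = 0
  superlinear : Tendsto (fun t => A t / t) atTop atTop

/-- The complementary function `Ā(t) = sup_{s > 0} (s t - A(s))`. The subtraction is truncated at
`0`, which does not change the supremum since `s t - A(s) → 0` as `s → 0` for a Young function. -/
def complementary (A : ℝ≥0 → ℝ≥0) (t : ℝ≥0) : ℝ≥0∞ :=
  ⨆ (s : ℝ≥0) (_ : 0 < s), ((s * t : ℝ≥0) : ℝ≥0∞) - (A s : ℝ≥0∞)

/-- `Φ ∈ B_p`: `∫_1^∞ Φ(t) / t^p dt/t < ∞`. -/
def MemB (p : ℝ) (Φ : ℝ≥0 → ℝ≥0∞) : Prop :=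
  ∫⁻ t in Set.Ioi (1 : ℝ), Φ t.toNNReal / ENNReal.ofReal (t ^ p) / ENNReal.ofReal t < ∞

/-- `Φ ∈ B_{p,q}`: `∫_1^∞ Φ(t)^{q/p} / t^q dt/t < ∞`. -/
def MemBpq (p q : ℝ) (Φ : ℝ≥0 → ℝ≥0∞) : Prop :=
  ∫⁻ t in Set.Ioi (1 : ℝ),
    Φ t.toNNReal ^ (q / p) / ENNReal.ofReal (t ^ q) / ENNReal.ofReal t < ∞

/-- The extension of `A : [0, ∞) → [0, ∞)` to `[0, ∞]` by `A(∞) = ∞`. -/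
def extendTop (A : ℝ≥0 → ℝ≥0) (t : ℝ≥0∞) : ℝ≥0∞ :=
  open Classical in if t = ∞ then ∞ else (A t.toNNReal : ℝ≥0∞)

/-- The Orlicz (Luxemburg) average `‖g‖_{A,Q}` of the nonnegative function `g`; it is `∞` if
there is no admissible `l`. -/
def orliczAvg {n : ℕ} (A : ℝ≥0 → ℝ≥0) (Q : Cube n) (g : (Fin n → ℝ) → ℝ≥0∞) : ℝ≥0∞ :=
  ⨅ (l : ℝ≥0) (_ : 0 < l ∧ (⨍⁻ x in Q.toSet, extendTop A (g x / l) ∂volume) ≤ 1), (l : ℝ≥0∞)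

/-- The average `‖g‖_{r,Q} = (|Q|⁻¹ ∫_Q g^r)^{1/r}`. -/
def lpAvg {n : ℕ} (r : ℝ) (Q : Cube n) (g : (Fin n → ℝ) → ℝ≥0∞) : ℝ≥0∞ :=
  (⨍⁻ x in Q.toSet, g x ^ r ∂volume) ^ (1 / r)

/-- `|b(x) - b_Q|^m`, where `b_Q` is the mean of `b` over `Q`. -/
def osc {n : ℕ} {𝕜 : Type*} [RCLike 𝕜] (b : (Fin n → ℝ) → 𝕜) (m : ℕ) (Q : Cube n)
    (x : Fin n → ℝ) : ℝ≥0∞ :=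
  ‖b x - ⨍ y in Q.toSet, b y‖ₑ ^ m

/-- The power `w^s` of a weight, as a function with values in `[0, ∞]`. -/
def wpow {n : ℕ} (w : (Fin n → ℝ) → ℝ) (s : ℝ) (x : Fin n → ℝ) : ℝ≥0∞ :=
  ENNReal.ofReal (w x) ^ s

/-- `‖g‖_{L^r(w)} = (∫ g^r w dx)^{1/r}` for nonnegative `g`. -/
def weightedNorm {n : ℕ} (r : ℝ) (w : (Fin n → ℝ) → ℝ) (g : (Fin n → ℝ) → ℝ≥0∞) : ℝ≥0∞ :=
  (∫⁻ x, g x ^ r * ENNReal.ofReal (w x)) ^ (1 / r)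

section Operators

variable {n : ℕ} {𝕜 : Type*} [RCLike 𝕜]

/-- `|Q|^{α/n} (|Q|⁻¹ ∫_Q |b - b_Q|^m |f|) χ_Q(x)`. -/
def sparseTerm (α : ℝ) (b : (Fin n → ℝ) → 𝕜) (m : ℕ) (Q : Cube n) (f : (Fin n → ℝ) → 𝕜) :
    (Fin n → ℝ) → ℝ≥0∞ :=
  Q.toSet.indicator fun _ =>
    volume Q.toSet ^ (α / n) * ⨍⁻ y in Q.toSet, osc b m Q y * ‖f y‖ₑ ∂volume

/-- `|Q|^{α/n} |b(x) - b_Q|^m (|Q|⁻¹ ∫_Q |f|) χ_Q(x)`. -/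
def sparseTermStar (α : ℝ) (b : (Fin n → ℝ) → 𝕜) (m : ℕ) (Q : Cube n) (f : (Fin n → ℝ) → 𝕜) :
    (Fin n → ℝ) → ℝ≥0∞ :=
  Q.toSet.indicator fun x =>
    volume Q.toSet ^ (α / n) * osc b m Q x * ⨍⁻ y in Q.toSet, ‖f y‖ₑ ∂volume

/-- The operator `T^{b,m}_{S,α}`, with a supremum over the cubes of `S`. -/
def sparseSup (S : Set (Cube n)) (α : ℝ) (b : (Fin n → ℝ) → 𝕜) (m : ℕ)
    (f : (Fin n → ℝ) → 𝕜) (x : Fin n → ℝ) : ℝ≥0∞ :=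
  ⨆ Q ∈ S, sparseTerm α b m Q f x

/-- The operator `(T^{b,m}_{S,α})^*`, with a supremum over the cubes of `S`. -/
def sparseSupStar (S : Set (Cube n)) (α : ℝ) (b : (Fin n → ℝ) → 𝕜) (m : ℕ)
    (f : (Fin n → ℝ) → 𝕜) (x : Fin n → ℝ) : ℝ≥0∞ :=
  ⨆ Q ∈ S, sparseTermStar α b m Q f x

/-- The operator `T^{b,m}_{S,α}`, with a sum over the cubes of `S`. -/
def sparseSum (S : Set (Cube n)) (α : ℝ) (b : (Fin n → ℝ) → 𝕜) (m : ℕ)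
    (f : (Fin n → ℝ) → 𝕜) (x : Fin n → ℝ) : ℝ≥0∞ :=
  ∑' Q : S, sparseTerm α b m Q f x

/-- The operator `(T^{b,m}_{S,α})^*`, with a sum over the cubes of `S`. -/
def sparseSumStar (S : Set (Cube n)) (α : ℝ) (b : (Fin n → ℝ) → 𝕜) (m : ℕ)
    (f : (Fin n → ℝ) → 𝕜) (x : Fin n → ℝ) : ℝ≥0∞ :=
  ∑' Q : S, sparseTermStar α b m Q f x

/-- `‖T f‖_{L^q(μ)} + ‖T' f‖_{L^q(μ)} ≲ ‖f‖_{L^p(ν)}`, with a constant independent of `f`. -/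
def BothBounded (p q : ℝ) (μ ν : (Fin n → ℝ) → ℝ)
    (T T' : ((Fin n → ℝ) → 𝕜) → (Fin n → ℝ) → ℝ≥0∞) : Prop :=
  ∃ K : ℝ≥0, ∀ f : (Fin n → ℝ) → 𝕜, AEStronglyMeasurable f volume →
    weightedNorm q μ (T f) + weightedNorm q μ (T' f) ≤ K * weightedNorm p ν (fun x => ‖f x‖ₑ)

end Operators

end

end SparseBump

namespace SparseBump

/-! ### Geometry of dyadic cubes -/

/-! Each sum dominates the matching supremum, and each supremum dominates its single terms.
Sufficiency is therefore needed only for the sums, and necessity only tests one cube at a time. Both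
operators have terms of the form |Q|^a w'(x) ⟨w|f|⟩_Q χ_Q(x) with a = α/n, where one of w, w' is |b
- b_Q|^m and the other is 1. The main estimates are proved for general w, w' and used twice.

Sufficiency. Pair the sum with g in L^{q'}(μ). On Q write w' g μ = (w' μ^{1/q})(g μ^{1/q'}) and w f
= (w ν^{-1/p})(f ν^{1/p}). Hölder's inequality for Orlicz averages,
`lintegral_mul_le_orliczAvg_mul_luxAvg`, and the bump condition leave a constant times |Q|^{1/q'} ‖g
μ^{1/q'}‖_{Ā,Q} · |Q|^{1/p} ‖f ν^{1/p}‖_{B̄,Q}. Hölder over the cubes with exponents q', q produces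
two sums, both controlled by `exists_carleson_embedding`: Σ |Q|^{q/p} ‖h‖_{Φ,Q}^q ≲ (∫ h^p)^{q/p}
for Φ in B_{p,q}. The first sum is the case p = q = q'.

The embedding is proved directly, with no maximal operator. By layer cake and sparsity it is enough
to sum, at each height t, over the maximal cubes above that height. A single-cube estimate
(`volume_rpow_mul_le_of_one_lt_laverage`) replaces |Q| t^q by an integral over Q of h^p times a
kernel. After Tonelli, the cubes containing a fixed x contribute integrals of one kernel over
disjoint sets (`sum_lintegral_maximalHeights_le`), and the B_{p,q} condition says that its total
integral is finite.

Necessity. On one cube test with truncations of (w/ν)^{p'-1}, the extremal function for the duality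
between L^p(ν) and its dual, divide by a power of the resulting average, and let the truncation tend
to infinity (`volume_rpow_mul_lpAvg_mul_lpAvg_le`). -/

lemma Cube.measurableSet_toSet {n : ℕ} (Q : Cube n) : MeasurableSet Q.toSet :=
  MeasurableSet.univ_pi fun _ => measurableSet_Ico

lemma Cube.volume_toSet {n : ℕ} (Q : Cube n) :
    volume Q.toSet = ENNReal.ofReal Q.side ^ n := by
  simp [Cube.toSet, volume_pi_pi, Real.volume_Ico]

lemma Cube.volume_ne_zero {n : ℕ} (Q : Cube n) : volume Q.toSet ≠ 0 := by
  rw [Q.volume_toSet]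
  exact pow_ne_zero _ (by simpa using Q.side_pos)

lemma Cube.volume_ne_top {n : ℕ} (Q : Cube n) : volume Q.toSet ≠ ∞ := by
  rw [Q.volume_toSet]
  exact ENNReal.pow_ne_top ENNReal.ofReal_ne_top

lemma Cube.toReal_volume_pos {n : ℕ} (Q : Cube n) : 0 < (volume Q.toSet).toReal :=
  ENNReal.toReal_pos Q.volume_ne_zero Q.volume_ne_top

lemma Cube.subset_Icc {n : ℕ} (Q : Cube n) :
    Q.toSet ⊆ Icc Q.corner (fun i => Q.corner i + Q.side) := fun _ hx =>
  ⟨fun i => (hx i (mem_univ i)).1, fun i => (hx i (mem_univ i)).2.le⟩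

lemma setLAverage_eq_inv_mul {n : ℕ} (Q : Cube n) (g : (Fin n → ℝ) → ℝ≥0∞) :
    ⨍⁻ x in Q.toSet, g x ∂volume = (volume Q.toSet)⁻¹ * ∫⁻ x in Q.toSet, g x := by
  rw [setLAverage_eq, ENNReal.div_eq_inv_mul]

lemma IsChild.subset {n : ℕ} {Q R : Cube n} (h : IsChild Q R) : R.toSet ⊆ Q.toSet := by
  intro x hx i hi
  have h1 : x i ∈ Ico (R.corner i) (R.corner i + R.side) := hx i hi
  change x i ∈ Ico (Q.corner i) (Q.corner i + Q.side)
  rw [h.1] at h1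
  have hQ := Q.side_pos
  rcases h.2 i with h2 | h2 <;> rw [h2] at h1 <;>
    exact ⟨by linarith [h1.1], by linarith [h1.2]⟩

lemma IsChild.eq_of_mem {n : ℕ} {Q R R' : Cube n} (h : IsChild Q R) (h' : IsChild Q R')
    {x : Fin n → ℝ} (hx : x ∈ R.toSet) (hx' : x ∈ R'.toSet) : R = R' := by
  ext i
  · have h1 : x i ∈ Ico (R.corner i) (R.corner i + R.side) := hx i (mem_univ i)
    have h2 : x i ∈ Ico (R'.corner i) (R'.corner i + R'.side) := hx' i (mem_univ i)
    rw [h.1] at h1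
    rw [h'.1] at h2
    have hQ := Q.side_pos
    rcases h.2 i with h3 | h3 <;> rcases h'.2 i with h4 | h4 <;>
      rw [h3] at h1 ⊢ <;> rw [h4] at h2 ⊢ <;> linarith [h1.1, h1.2, h2.1, h2.2]
  · rw [h.1, h'.1]

lemma subset_of_mem_descendants {n : ℕ} {Q R : Cube n} (h : R ∈ descendants Q) :
    R.toSet ⊆ Q.toSet := by
  induction h with
  | refl => exact Subset.rfl
  | tail _ h ih => exact h.subset.trans ih

/-- The strict order of cubes by inclusion. -/
def Cube.Below {n : ℕ} (Q R : Cube n) : Prop := Q.toSet ⊆ R.toSet ∧ Q.side < R.side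

lemma eq_or_below_of_mem_descendants {n : ℕ} {Q R : Cube n} (h : R ∈ descendants Q) :
    R = Q ∨ R.Below Q := by
  have key : R = Q ∨ R.side < Q.side := by
    induction h with
    | refl => exact Or.inl rfl
    | @tail A B _ h ih =>
      have := h.1
      have := A.side_pos
      rcases ih with rfl | ih
      · right; linarith
      · right; linarith
  exact key.imp_right fun hs => ⟨subset_of_mem_descendants h, hs⟩

/-- Induction down the chain from P to Q. If both cubes lie strictly below P, the first children on
the two chains share x, hence coincide, and the induction moves to that child. -/
lemma descendants_comparable {n : ℕ} {P Q : Cube n} (hQ : Q ∈ descendants P)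
    {x : Fin n → ℝ} (hxQ : x ∈ Q.toSet) :
    ∀ R ∈ descendants P, x ∈ R.toSet → R ∈ descendants Q ∨ Q ∈ descendants R := by
  refine Relation.ReflTransGen.head_induction_on hQ (fun R hR _ => Or.inl hR) ?_
  intro P Q₁ hPQ hQ₁ ih R hR hxR
  rcases Relation.ReflTransGen.cases_head hR with rfl | ⟨R₁, hPR, hR₁⟩
  · exact Or.inr (Relation.ReflTransGen.head hPQ hQ₁)
  · have : Q₁ = R₁ := hPQ.eq_of_mem hPR (subset_of_mem_descendants hQ₁ hxQ)
      (subset_of_mem_descendants hR₁ hxR)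
    subst this
    exact ih R hR₁ hxR

lemma IsDyadicLattice.trichotomy {n : ℕ} {D : Set (Cube n)} (hD : IsDyadicLattice D)
    {Q R : Cube n} (hQ : Q ∈ D) (hR : R ∈ D) {x : Fin n → ℝ} (hxQ : x ∈ Q.toSet)
    (hxR : x ∈ R.toSet) : Q = R ∨ Q.Below R ∨ R.Below Q := by
  obtain ⟨P, _, h1, h2⟩ := hD.common_ancestor Q hQ R hR
  rcases descendants_comparable h1 hxQ R h2 hxR with h | h
  · rcases eq_or_below_of_mem_descendants h with h | h
    · exact Or.inl h.symm
    · exact Or.inr (Or.inr h)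
  · rcases eq_or_below_of_mem_descendants h with h | h
    · exact Or.inl h
    · exact Or.inr (Or.inl h)

/-! ### Sparse families -/

/-- The sets E_Q are disjoint and of positive measure, and Lebesgue measure is σ-finite.
Countability gives measurability of sums over S and their interchange with integrals. -/
lemma IsEtaSparse.countable {n : ℕ} {η : ℝ} (hη : 0 < η) {S : Set (Cube n)}
    (hS : IsEtaSparse η S) : S.Countable := by
  obtain ⟨E, hE, hd⟩ := hS
  have h := Measure.countable_meas_pos_of_disjoint_iUnion (μ := (volume : Measure (Fin n → ℝ)))
    (As := fun Q : S => E Q) (fun Q => (hE Q Q.2).1)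
    (fun Q R hQR => hd Q.2 R.2 (fun h => hQR (Subtype.ext h)))
  have : {Q : S | 0 < volume (E Q)} = univ := by
    refine eq_univ_of_forall fun Q => ?_
    refine lt_of_lt_of_le ?_ (hE Q Q.2).2.2
    exact ENNReal.mul_pos (by simpa using hη) Q.1.volume_ne_zero
  rw [this] at h
  exact countable_coe_iff.mp (countable_univ_iff.mp h)

open Classical in
/-- The cubes of a finite sparse family have total measure at most `1 / η` times that of the
maximal ones. -/
lemma IsEtaSparse.sum_volume_le {n : ℕ} {η : ℝ} (hη : 0 < η) {S : Set (Cube n)}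
    (hS : IsEtaSparse η S) (F : Finset (Cube n)) (hF : ∀ Q ∈ F, Q ∈ S) :
    ∑ Q ∈ F, volume Q.toSet ≤
      (ENNReal.ofReal η)⁻¹ * ∑ Q ∈ F with ∀ R ∈ F, ¬ Q.Below R, volume Q.toSet := by
  obtain ⟨E, hE, hd⟩ := hS
  have hη0 : ENNReal.ofReal η ≠ 0 := by simpa using hη
  calc ∑ Q ∈ F, volume Q.toSet
      ≤ ∑ Q ∈ F, (ENNReal.ofReal η)⁻¹ * volume (E Q) := by
        refine Finset.sum_le_sum fun Q hQ => ?_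
        rw [mul_comm, ← div_eq_mul_inv, ENNReal.le_div_iff_mul_le (Or.inl hη0)
          (Or.inl ENNReal.ofReal_ne_top), mul_comm]
        exact (hE Q (hF Q hQ)).2.2
    _ = (ENNReal.ofReal η)⁻¹ * volume (⋃ Q ∈ F, E Q) := by
        rw [← Finset.mul_sum, measure_biUnion_finset]
        · exact fun Q hQ R hR h => hd (hF Q hQ) (hF R hR) h
        · exact fun Q hQ => (hE Q (hF Q hQ)).1
    _ ≤ (ENNReal.ofReal η)⁻¹ *
          volume (⋃ Q ∈ F.filter (fun Q => ∀ R ∈ F, ¬ Q.Below R), Q.toSet) := by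
        refine mul_le_mul' le_rfl (measure_mono fun x hx => ?_)
        simp only [mem_iUnion, exists_prop] at hx ⊢
        obtain ⟨Q, hQ, hxQ⟩ := hx
        -- A cube of largest side among those of F containing Q is maximal in F: anything above it
        -- would also contain Q and have larger side.
        have hne : (F.filter fun R => Q.toSet ⊆ R.toSet).Nonempty :=
          ⟨Q, by simp [hQ]⟩
        obtain ⟨P, hP, hmax⟩ := Finset.exists_max_image _ (fun R => R.side) hne
        rw [Finset.mem_filter] at hP
        refine ⟨P, Finset.mem_filter.mpr ⟨hP.1, fun R hR hPR => ?_⟩,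
          hP.2 ((hE Q (hF Q hQ)).2.1 hxQ)⟩
        exact absurd (hmax R (Finset.mem_filter.mpr ⟨hR, hP.2.trans hPR.1⟩)) (not_le.mpr hPR.2)
    _ ≤ _ := by
        gcongr
        exact measure_biUnion_finset_le _ _

/-! ### A Carleson embedding for Orlicz averages -/

/-- Jensen's inequality for the measure with density `u`. -/
lemma lintegral_mul_rpow_le {X : Type*} [MeasurableSpace X] {μ : Measure X} {u v : X → ℝ≥0∞}
    (hu : AEMeasurable u μ) (hv : AEMeasurable v μ) {r : ℝ} (hr : 1 ≤ r) :
    (∫⁻ x, u x * v x ∂μ) ^ r ≤ (∫⁻ x, u x ∂μ) ^ (r - 1) * ∫⁻ x, u x * v x ^ r ∂μ := by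
  have hr0 : 0 < r := by linarith
  have h1 : 0 ≤ 1 - 1 / r := by
    rw [sub_nonneg, div_le_one hr0]; exact hr
  have h := ENNReal.lintegral_mul_norm_pow_le hu (hu.mul (hv.pow_const r)) h1
    (by positivity : 0 ≤ 1 / r) (by ring)
  have h2 : ∀ x, u x * v x ≤ u x ^ (1 - 1 / r) * (u x * v x ^ r) ^ (1 / r) := by
    intro x
    rw [ENNReal.mul_rpow_of_nonneg _ _ (by positivity), ← mul_assoc,
      ← ENNReal.rpow_add_of_nonneg _ _ h1 (by positivity), ← ENNReal.rpow_mul,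
      mul_one_div_cancel hr0.ne']
    simp
  calc (∫⁻ x, u x * v x ∂μ) ^ r
      ≤ ((∫⁻ x, u x ∂μ) ^ (1 - 1 / r) * (∫⁻ x, u x * v x ^ r ∂μ) ^ (1 / r)) ^ r :=
        ENNReal.rpow_le_rpow ((lintegral_mono h2).trans h) hr0.le
    _ = _ := by
        rw [ENNReal.mul_rpow_of_nonneg _ _ hr0.le, ← ENNReal.rpow_mul, ← ENNReal.rpow_mul]
        congr 2
        · field_simp
        · rw [one_div_mul_cancel hr0.ne', ENNReal.rpow_one]

/-! ### Layer cake over maximal cubes. -/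

/-- The change of variables `s = c / t` in the measure `dt / t`. -/
lemma lintegral_image_const_div {c : ℝ} (hc : 0 < c) {I : Set ℝ} (hI : MeasurableSet I)
    (hI0 : I ⊆ Ioi 0) (κ : ℝ → ℝ≥0∞) :
    ∫⁻ s in (fun t => c / t) '' I, κ s / ENNReal.ofReal s =
      ∫⁻ t in I, κ (c / t) / ENNReal.ofReal t := by
  rw [lintegral_image_eq_lintegral_abs_deriv_mul (f' := fun t => -c / t ^ 2) hI]
  · refine setLIntegral_congr_fun hI fun t ht => ?_
    have ht0 : 0 < t := hI0 ht
    have e : |-c / t ^ 2| = (c / t) * t⁻¹ := by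
      rw [neg_div, abs_neg, abs_of_pos (by positivity)]
      field_simp
    have h1 : ENNReal.ofReal (c / t) ≠ 0 := by
      simpa using div_pos hc ht0
    simp only [e]
    rw [ENNReal.ofReal_mul (by positivity), ENNReal.ofReal_inv_of_pos ht0, ENNReal.div_eq_inv_mul,
      ENNReal.div_eq_inv_mul]
    calc ENNReal.ofReal (c / t) * (ENNReal.ofReal t)⁻¹ *
          ((ENNReal.ofReal (c / t))⁻¹ * κ (c / t))
        = (ENNReal.ofReal (c / t) * (ENNReal.ofReal (c / t))⁻¹) *
          ((ENNReal.ofReal t)⁻¹ * κ (c / t)) := by ring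
      _ = _ := by rw [ENNReal.mul_inv_cancel h1 ENNReal.ofReal_ne_top, one_mul]
  · intro t ht
    have ht0 : t ≠ 0 := (hI0 ht).ne'
    have := (hasDerivAt_inv ht0).const_mul c
    refine (this.congr_deriv ?_).hasDerivWithinAt
    ring
  · intro t ht t' ht' h
    have ht0 : t ≠ 0 := (hI0 ht).ne'
    have ht0' : t' ≠ 0 := (hI0 ht').ne'
    have h : c / t = c / t' := h
    field_simp at h
    exact h.symm

/-- The heights `t` at which `Q` is a maximal member of `{R ∈ F | t < a R}`. -/
def maximalHeights {n : ℕ} (F : Finset (Cube n)) (a : Cube n → ℝ) (Q : Cube n) : Set ℝ :=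
  {t | 0 < t ∧ t < a Q ∧ ∀ R ∈ F, Q.Below R → a R ≤ t}

lemma measurableSet_maximalHeights {n : ℕ} (F : Finset (Cube n)) (a : Cube n → ℝ)
    (Q : Cube n) : MeasurableSet (maximalHeights F a Q) := by
  have : maximalHeights F a Q =
      Ioi 0 ∩ (Iio (a Q) ∩ ⋂ R ∈ F, ⋂ (_ : Q.Below R), Ici (a R)) := by
    ext t
    simp [maximalHeights]
  rw [this]
  refine measurableSet_Ioi.inter (measurableSet_Iio.inter ?_)
  exact F.measurableSet_biInter fun R _ => MeasurableSet.iInter fun _ => measurableSet_Ici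

open Classical in
-- The cubes through x form a chain. Substituting s = h|Q|^δ/t turns each summand into an integral
-- of the same function κ(s)/s over a set J Q, and these sets are disjoint along the chain.
lemma sum_lintegral_maximalHeights_le {n : ℕ} {D : Set (Cube n)} (hD : IsDyadicLattice D)
    (F : Finset (Cube n)) (hF : ∀ Q ∈ F, Q ∈ D) (a : Cube n → ℝ) {δ : ℝ} (hδ : 0 ≤ δ)
    (κ : ℝ → ℝ≥0∞) (hκ0 : κ 0 = 0) {h : ℝ} (hh : 0 ≤ h) (x : Fin n → ℝ) :
    ∑ Q ∈ F with x ∈ Q.toSet, ∫⁻ t in maximalHeights F a Q,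
        κ (h * (volume Q.toSet).toReal ^ δ / t) / ENNReal.ofReal t ≤
      ∫⁻ s in Ioi (0 : ℝ), κ s / ENNReal.ofReal s := by
  -- For h = 0 the substitution degenerates; every integrand is then κ 0 = 0.
  rcases hh.eq_or_lt with rfl | hh
  · simp [hκ0]
  set c : Cube n → ℝ := fun Q => h * (volume Q.toSet).toReal ^ δ with hc
  have hc0 : ∀ Q, 0 < c Q := fun Q => mul_pos hh (Real.rpow_pos_of_pos Q.toReal_volume_pos _)
  have hI0 : ∀ Q, maximalHeights F a Q ⊆ Ioi 0 := fun Q t ht => ht.1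
  set J : Cube n → Set ℝ := fun Q => (fun t => c Q / t) '' maximalHeights F a Q with hJ
  have hJmeas : ∀ Q, MeasurableSet (J Q) := fun Q => by
    refine (measurableSet_maximalHeights F a Q).image_of_measurable_injOn
      (measurable_const.div measurable_id) ?_
    intro t ht t' ht' h
    have ht0 : t ≠ 0 := (hI0 Q ht).ne'
    have ht0' : t' ≠ 0 := (hI0 Q ht').ne'
    have h : c Q / t = c Q / t' := h
    have := (hc0 Q).ne'
    field_simp at h
    exact h.symm
  -- A smaller cube Q has only heights t ≥ a R, while R has only heights t' < a R. Since also |Q|^δ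
  -- ≤ |R|^δ, every s coming from Q is strictly smaller than every s coming from R.
  have hbelow : ∀ Q R, R ∈ F → Q.Below R → Disjoint (J Q) (J R) := by
    intro Q R hR hQR
    rw [Set.disjoint_left]
    rintro _ ⟨t, ht, rfl⟩ ⟨t', ht', hEq⟩
    have h1 : t' < t := ht'.2.1.trans_le (ht.2.2 R hR hQR)
    have h2 : c Q ≤ c R := by
      refine mul_le_mul_of_nonneg_left (Real.rpow_le_rpow ENNReal.toReal_nonneg ?_ hδ) hh.le
      exact ENNReal.toReal_mono R.volume_ne_top (measure_mono hQR.1)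
    have h3 : c Q / t < c R / t' :=
      lt_of_lt_of_le (div_lt_div_of_pos_left (hc0 Q) ht'.1 h1)
        (div_le_div_of_nonneg_right h2 ht'.1.le)
    exact h3.ne hEq.symm
  have hdisj : Set.PairwiseDisjoint (↑(F.filter fun Q => x ∈ Q.toSet)) J := by
    intro Q hQ R hR hne
    simp only [Finset.coe_filter, mem_ofPred_eq] at hQ hR
    rcases hD.trichotomy (hF Q hQ.1) (hF R hR.1) hQ.2 hR.2 with h | h | h
    · exact absurd h hne
    · exact hbelow Q R hR.1 h
    · exact (hbelow R Q hQ.1 h).symm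
  calc ∑ Q ∈ F with x ∈ Q.toSet, ∫⁻ t in maximalHeights F a Q,
        κ (c Q / t) / ENNReal.ofReal t
      = ∑ Q ∈ F with x ∈ Q.toSet, ∫⁻ s in J Q, κ s / ENNReal.ofReal s :=
        Finset.sum_congr rfl fun Q _ => (lintegral_image_const_div (hc0 Q)
          (measurableSet_maximalHeights F a Q) (hI0 Q) κ).symm
    _ = ∫⁻ s in ⋃ Q ∈ F.filter (fun Q => x ∈ Q.toSet), J Q, κ s / ENNReal.ofReal s :=
        (lintegral_biUnion_finset hdisj (fun Q _ => hJmeas Q) _).symm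
    _ ≤ _ := by
        refine lintegral_mono_set (iUnion₂_subset fun Q _ => ?_)
        rintro _ ⟨t, ht, rfl⟩
        exact div_pos (hc0 Q) ht.1

lemma lintegral_Ioo_rpow {a q : ℝ} (ha : 0 ≤ a) (hq : 0 < q) :
    ∫⁻ t in Ioo 0 a, ENNReal.ofReal (t ^ (q - 1)) =
      (ENNReal.ofReal q)⁻¹ * ENNReal.ofReal (a ^ q) := by
  have hint : IntervalIntegrable (fun t : ℝ => t ^ (q - 1)) volume 0 a :=
    intervalIntegral.intervalIntegrable_rpow' (by linarith)
  rw [Measure.restrict_congr_set Ioo_ae_eq_Ioc, ← ofReal_integral_eq_lintegral_ofReal]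
  · rw [← intervalIntegral.integral_of_le ha, integral_rpow (Or.inl (by linarith)),
      sub_add_cancel, Real.zero_rpow hq.ne', sub_zero, div_eq_inv_mul,
      ENNReal.ofReal_mul (by positivity), ENNReal.ofReal_inv_of_pos hq]
  · exact (intervalIntegrable_iff_integrableOn_Ioc_of_le ha).mp hint
  · refine (ae_restrict_iff' measurableSet_Ioc).mpr (ae_of_all _ fun t ht => ?_)
    exact Real.rpow_nonneg ht.1.le _

open Classical in
/-- A layer-cake argument: a single-cube estimate at all heights `t < a Q` sums up over sparse
families. -/
lemma IsEtaSparse.sum_le_of_forall_height {n : ℕ} {η : ℝ} (hη : 0 < η) {S D : Set (Cube n)}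
    (hD : IsDyadicLattice D) (hSD : S ⊆ D) (hS : IsEtaSparse η S)
    (F : Finset (Cube n)) (hF : ∀ Q ∈ F, Q ∈ S) {a : Cube n → ℝ} (ha : ∀ Q ∈ F, 0 ≤ a Q)
    {δ q : ℝ} (hδ : 0 ≤ δ) (hq : 0 < q) {κ : ℝ → ℝ≥0∞} (hκ : Measurable κ) (hκ0 : κ 0 = 0)
    {h : (Fin n → ℝ) → ℝ≥0} (hh : AEMeasurable h) {u : (Fin n → ℝ) → ℝ≥0∞}
    (hu : AEMeasurable u) (A : ℝ≥0∞)
    (H : ∀ Q ∈ F, ∀ t, 0 < t → t < a Q → volume Q.toSet * ENNReal.ofReal (t ^ q) ≤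
      A * ∫⁻ x in Q.toSet, u x * κ (h x * (volume Q.toSet).toReal ^ δ / t)) :
    ∑ Q ∈ F, volume Q.toSet * ENNReal.ofReal (a Q ^ q) ≤
      ENNReal.ofReal q * (ENNReal.ofReal η)⁻¹ * A *
        (∫⁻ s in Ioi (0 : ℝ), κ s / ENNReal.ofReal s) * ∫⁻ x, u x := by
  have hq0 : ENNReal.ofReal q ≠ 0 := by simpa using hq
  have hrpow : Measurable fun t : ℝ => ENNReal.ofReal (t ^ (q - 1)) := by fun_prop
  -- Layer cake for one cube: a^q = q ∫_0^a t^{q-1} dt.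
  have step1 : ∀ Q ∈ F, volume Q.toSet * ENNReal.ofReal (a Q ^ q) =
      ENNReal.ofReal q * ∫⁻ t in Ioi (0 : ℝ),
        ENNReal.ofReal (t ^ (q - 1)) * (if t < a Q then volume Q.toSet else 0) := by
    intro Q hQ
    have e : ∫⁻ t in Ioi (0 : ℝ),
        ENNReal.ofReal (t ^ (q - 1)) * (if t < a Q then volume Q.toSet else 0) =
        ∫⁻ t in Ioo (0 : ℝ) (a Q), ENNReal.ofReal (t ^ (q - 1)) * volume Q.toSet := by
      rw [← lintegral_indicator measurableSet_Ioi, ← lintegral_indicator measurableSet_Ioo]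
      refine lintegral_congr fun t => ?_
      by_cases h1 : 0 < t <;> by_cases h2 : t < a Q <;> simp [indicator, h1, h2]
    rw [e, lintegral_mul_const _ hrpow, lintegral_Ioo_rpow (ha Q hQ) hq, ← mul_assoc,
      ← mul_assoc, ENNReal.mul_inv_cancel hq0 ENNReal.ofReal_ne_top, one_mul, mul_comm]
  have hmeas1 : ∀ Q : Cube n, Measurable fun t : ℝ =>
      ENNReal.ofReal (t ^ (q - 1)) * (if t < a Q then volume Q.toSet else 0) := fun Q =>
    hrpow.mul (Measurable.ite measurableSet_Iio measurable_const measurable_const)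
  have hmeas2 : ∀ Q : Cube n, Measurable fun t : ℝ => ENNReal.ofReal (t ^ (q - 1)) *
      (maximalHeights F a Q).indicator (fun _ => volume Q.toSet) t := fun Q =>
    hrpow.mul (measurable_const.indicator (measurableSet_maximalHeights F a Q))
  -- Sparsity is applied at each height t to the subfamily {a Q > t}, whose maximal members are
  -- exactly the cubes having t among their maximal heights.
  have step2 : ∀ t ∈ Ioi (0 : ℝ), ∑ Q ∈ F, (if t < a Q then volume Q.toSet else 0) ≤
      (ENNReal.ofReal η)⁻¹ * ∑ Q ∈ F,
        (maximalHeights F a Q).indicator (fun _ => volume Q.toSet) t := by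
    intro t ht
    rw [← Finset.sum_filter]
    refine (hS.sum_volume_le hη _ fun Q hQ => hF Q (Finset.mem_filter.mp hQ).1).trans ?_
    refine mul_le_mul' le_rfl ?_
    rw [Finset.filter_filter, Finset.sum_filter]
    refine Finset.sum_le_sum fun Q hQ => ?_
    split_ifs with hc
    · rw [indicator_of_mem]
      refine ⟨ht, hc.1, fun R hR hQR => ?_⟩
      by_contra hlt
      exact hc.2 R (Finset.mem_filter.mpr ⟨hR, not_le.mp hlt⟩) hQR
    · exact zero_le
  -- Since t^{q-1} = t^q / t, the single-cube hypothesis leaves the measure dt/t, and Tonelli brings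
  -- the t-integral inside.
  have step3 : ∀ Q ∈ F, ∫⁻ t in Ioi (0 : ℝ), ENNReal.ofReal (t ^ (q - 1)) *
        (maximalHeights F a Q).indicator (fun _ => volume Q.toSet) t ≤
      A * ∫⁻ x, u x * Q.toSet.indicator (fun _ => ∫⁻ t in maximalHeights F a Q,
        κ (h x * (volume Q.toSet).toReal ^ δ / t) / ENNReal.ofReal t) x := by
    intro Q hQ
    set I := maximalHeights F a Q with hI
    have hIm : MeasurableSet I := measurableSet_maximalHeights F a Q
    set V := (volume Q.toSet).toReal ^ δ with hV
    have hjoint : AEMeasurable (Function.uncurry fun (t : ℝ) (x : Fin n → ℝ) =>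
        u x * (κ (h x * V / t) / ENNReal.ofReal t))
        ((volume.restrict I).prod (volume.restrict Q.toSet)) := by
      have hx : AEMeasurable (fun z : ℝ × (Fin n → ℝ) => h z.2)
          ((volume.restrict I).prod (volume.restrict Q.toSet)) := hh.restrict.comp_snd
      have hux : AEMeasurable (fun z : ℝ × (Fin n → ℝ) => u z.2)
          ((volume.restrict I).prod (volume.restrict Q.toSet)) := hu.restrict.comp_snd
      refine hux.mul (AEMeasurable.div (hκ.comp_aemeasurable ?_) ?_)
      · exact (hx.coe_nnreal_real.mul_const V).div measurable_fst.aemeasurable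
      · exact measurable_fst.ennreal_ofReal.aemeasurable
    calc ∫⁻ t in Ioi (0 : ℝ), ENNReal.ofReal (t ^ (q - 1)) *
          I.indicator (fun _ => volume Q.toSet) t
        = ∫⁻ t in I, ENNReal.ofReal (t ^ (q - 1)) * volume Q.toSet := by
          rw [← lintegral_indicator measurableSet_Ioi, ← lintegral_indicator hIm]
          refine lintegral_congr fun t => ?_
          by_cases h1 : t ∈ I
          · have : t ∈ Ioi (0 : ℝ) := h1.1
            simp only [indicator_of_mem h1, indicator_of_mem this]
          · by_cases h2 : t ∈ Ioi (0 : ℝ) <;> simp [h1]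
      _ ≤ ∫⁻ t in I, A * ∫⁻ x in Q.toSet,
            u x * (κ (h x * V / t) / ENNReal.ofReal t) := by
          refine setLIntegral_mono' hIm fun t ht => ?_
          have ht0 : 0 < t := ht.1
          have e : ENNReal.ofReal (t ^ (q - 1)) =
              ENNReal.ofReal (t ^ q) * (ENNReal.ofReal t)⁻¹ := by
            rw [← ENNReal.ofReal_inv_of_pos ht0, ← ENNReal.ofReal_mul (by positivity),
              Real.rpow_sub_one ht0.ne', div_eq_mul_inv]
          have e2 : ∫⁻ x in Q.toSet, u x * (κ (h x * V / t) / ENNReal.ofReal t) =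
              (∫⁻ x in Q.toSet, u x * κ (h x * V / t)) * (ENNReal.ofReal t)⁻¹ := by
            rw [← lintegral_mul_const' _ _ (by simpa using ht0)]
            simp only [div_eq_mul_inv, mul_assoc]
          rw [e, e2, ← mul_assoc, mul_right_comm]
          refine mul_le_mul' ?_ le_rfl
          rw [mul_comm]
          exact H Q hQ t ht0 ht.2.1
      _ = A * ∫⁻ t in I, ∫⁻ x in Q.toSet,
            u x * (κ (h x * V / t) / ENNReal.ofReal t) := by
          rw [lintegral_const_mul'']
          exact hjoint.lintegral_prod_right'
      _ = A * ∫⁻ x in Q.toSet, ∫⁻ t in I,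
            u x * (κ (h x * V / t) / ENNReal.ofReal t) := by
          rw [lintegral_lintegral_swap hjoint]
      _ = _ := by
          rw [← lintegral_indicator Q.measurableSet_toSet]
          congr 1
          refine lintegral_congr fun x => ?_
          by_cases hx : x ∈ Q.toSet
          · simp only [indicator_of_mem hx]
            rw [lintegral_const_mul]
            exact (hκ.comp (measurable_const.div measurable_id)).div
              ENNReal.measurable_ofReal
          · simp [hx]
  have hinner : ∀ Q : Cube n, AEMeasurable (fun x => u x * Q.toSet.indicator (fun _ =>
      ∫⁻ t in maximalHeights F a Q,
        κ (h x * (volume Q.toSet).toReal ^ δ / t) / ENNReal.ofReal t) x) volume := by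
    intro Q
    refine hu.mul ?_
    have hm : Measurable fun y : ℝ≥0 => ∫⁻ t in maximalHeights F a Q,
        κ (y * (volume Q.toSet).toReal ^ δ / t) / ENNReal.ofReal t := by
      refine Measurable.lintegral_prod_right' (f := fun z : ℝ≥0 × ℝ =>
        κ (z.1 * (volume Q.toSet).toReal ^ δ / z.2) / ENNReal.ofReal z.2) ?_
      exact (hκ.comp (by fun_prop)).div (by fun_prop)
    exact (hm.comp_aemeasurable hh).indicator Q.measurableSet_toSet
  calc ∑ Q ∈ F, volume Q.toSet * ENNReal.ofReal (a Q ^ q)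
      = ENNReal.ofReal q * ∫⁻ t in Ioi (0 : ℝ), ENNReal.ofReal (t ^ (q - 1)) *
          ∑ Q ∈ F, (if t < a Q then volume Q.toSet else 0) := by
        rw [Finset.sum_congr rfl step1, ← Finset.mul_sum, ← lintegral_finsetSum _
          fun Q _ => hmeas1 Q]
        simp only [Finset.mul_sum]
    _ ≤ ENNReal.ofReal q * ∫⁻ t in Ioi (0 : ℝ), (ENNReal.ofReal η)⁻¹ * ∑ Q ∈ F,
          ENNReal.ofReal (t ^ (q - 1)) *
          (maximalHeights F a Q).indicator (fun _ => volume Q.toSet) t := by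
        refine mul_le_mul' le_rfl (setLIntegral_mono' measurableSet_Ioi fun t ht => ?_)
        rw [← Finset.mul_sum, mul_left_comm]
        exact mul_le_mul' le_rfl (step2 t ht)
    _ = ENNReal.ofReal q * (ENNReal.ofReal η)⁻¹ * ∑ Q ∈ F, ∫⁻ t in Ioi (0 : ℝ),
          ENNReal.ofReal (t ^ (q - 1)) *
          (maximalHeights F a Q).indicator (fun _ => volume Q.toSet) t := by
        rw [lintegral_const_mul _ (Finset.measurable_sum _ fun Q _ => hmeas2 Q),
          lintegral_finsetSum _ fun Q _ => hmeas2 Q, mul_assoc]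
    _ ≤ ENNReal.ofReal q * (ENNReal.ofReal η)⁻¹ * ∑ Q ∈ F, A * ∫⁻ x, u x *
          Q.toSet.indicator (fun _ => ∫⁻ t in maximalHeights F a Q,
            κ (h x * (volume Q.toSet).toReal ^ δ / t) / ENNReal.ofReal t) x :=
        mul_le_mul' le_rfl (Finset.sum_le_sum step3)
    _ = ENNReal.ofReal q * (ENNReal.ofReal η)⁻¹ * A * ∫⁻ x, u x * ∑ Q ∈ F,
          Q.toSet.indicator (fun _ => ∫⁻ t in maximalHeights F a Q,
            κ (h x * (volume Q.toSet).toReal ^ δ / t) / ENNReal.ofReal t) x := by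
        rw [← Finset.mul_sum, ← lintegral_finsetSum' _ fun Q _ => hinner Q, ← mul_assoc]
        simp only [Finset.mul_sum]
    _ ≤ ENNReal.ofReal q * (ENNReal.ofReal η)⁻¹ * A * ∫⁻ x, u x *
          ∫⁻ s in Ioi (0 : ℝ), κ s / ENNReal.ofReal s := by
        refine mul_le_mul' le_rfl (lintegral_mono fun x => mul_le_mul' le_rfl ?_)
        refine le_trans (le_of_eq ?_) (sum_lintegral_maximalHeights_le hD F
          (fun Q hQ => hSD (hF Q hQ)) a hδ κ hκ0 (h x).2 x)
        rw [Finset.sum_filter]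
        exact Finset.sum_congr rfl fun Q _ => by simp [indicator]
    _ = _ := by
        rw [lintegral_mul_const'' _ hu]
        ring

/-! ### The bump kernel and the embedding for Luxemburg averages. -/

/-- The Luxemburg average on `Q` given by an extended-valued Young function `Φ`. -/
noncomputable def luxAvg {n : ℕ} (Φ : ℝ≥0 → ℝ≥0∞) (Q : Cube n) (h : (Fin n → ℝ) → ℝ≥0) : ℝ≥0∞ :=
  ⨅ (l : ℝ≥0) (_ : 0 < l ∧ ⨍⁻ x in Q.toSet, Φ (h x / l) ∂volume ≤ 1), (l : ℝ≥0∞)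

open Classical in
/-- The density `Φ(s)^{q/p} / s^q` cut off near the origin. -/
noncomputable def bumpKernel (p q : ℝ) (c : ℝ≥0) (Φ : ℝ≥0 → ℝ≥0∞) (s : ℝ) : ℝ≥0∞ :=
  if (c : ℝ) < s then Φ s.toNNReal ^ (q / p) / ENNReal.ofReal (s ^ q) else 0

lemma measurable_bumpKernel (p q : ℝ) (c : ℝ≥0) {Φ : ℝ≥0 → ℝ≥0∞} (hΦ : Monotone Φ) :
    Measurable (bumpKernel p q c Φ) := by
  refine Measurable.ite measurableSet_Ioi ?_ measurable_const
  exact ((hΦ.measurable.comp measurable_real_toNNReal).pow_const _).div (by fun_prop)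

/-- On (0, 1] the cut-off keeps s above c and monotonicity bounds Φ by Φ(1), so the integrand is
bounded; on (1, ∞) it is at most the integrand of the B_{p,q} condition. -/
lemma lintegral_bumpKernel_lt_top {p q : ℝ} (hp : 0 < p) (hpq : p ≤ q) {c : ℝ≥0} (hc : 0 < c)
    {Φ : ℝ≥0 → ℝ≥0∞} (hΦ : Monotone Φ) (hΦ1 : Φ 1 ≠ ∞) (hB : MemBpq p q Φ) :
    ∫⁻ s in Ioi (0 : ℝ), bumpKernel p q c Φ s / ENNReal.ofReal s < ∞ := by
  have hq : 0 < q := hp.trans_le hpq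
  have hc' : (0 : ℝ) < c := hc
  have hr : 0 ≤ q / p := by positivity
  have hsplit : Ioi (0 : ℝ) = Ioc 0 1 ∪ Ioi 1 := (Ioc_union_Ioi_eq_Ioi zero_le_one).symm
  rw [hsplit]
  refine (lintegral_union_le _ _ _).trans_lt (ENNReal.add_lt_top.mpr ⟨?_, ?_⟩)
  · have hbd : ∀ s ∈ Ioc (0 : ℝ) 1, bumpKernel p q c Φ s / ENNReal.ofReal s ≤
        Φ 1 ^ (q / p) / ENNReal.ofReal (c ^ q) / ENNReal.ofReal c := by
      intro s hs
      unfold bumpKernel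
      split_ifs with h
      · refine ENNReal.div_le_div (ENNReal.div_le_div (ENNReal.rpow_le_rpow (hΦ ?_) hr) ?_) ?_
        · simpa using hs.2
        · exact ENNReal.ofReal_le_ofReal (Real.rpow_le_rpow hc'.le h.le hq.le)
        · exact ENNReal.ofReal_le_ofReal h.le
      · simp
    refine (setLIntegral_mono' measurableSet_Ioc hbd).trans_lt ?_
    rw [setLIntegral_const]
    refine ENNReal.mul_lt_top ?_ (by simp)
    have h1 : ENNReal.ofReal ((c : ℝ) ^ q) ≠ 0 := by
      simpa using Real.rpow_pos_of_pos hc' q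
    have h2 : ENNReal.ofReal (c : ℝ) ≠ 0 := by simpa using hc.ne'
    exact ENNReal.div_lt_top (ENNReal.div_lt_top
      (ENNReal.rpow_lt_top_of_nonneg hr hΦ1).ne h1).ne h2
  · refine lt_of_le_of_lt (lintegral_mono fun s => ?_) hB
    unfold bumpKernel
    split_ifs
    · exact le_rfl
    · simp

lemma le_two_mul_of_le_half_add {a b : ℝ≥0∞} (ha : a ≠ ∞) (h : a ≤ 2⁻¹ * a + b) :
    a ≤ 2 * b := by
  have h1 : (2 : ℝ≥0∞)⁻¹ * a ≠ ∞ := ENNReal.mul_ne_top (by simp) ha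
  have h2 : 2⁻¹ * a + 2⁻¹ * a ≤ 2⁻¹ * a + b := by
    rwa [← add_mul, ENNReal.inv_two_add_inv_two, one_mul]
  have h3 : 2⁻¹ * a ≤ b := (ENNReal.add_le_add_iff_left h1).mp h2
  calc a = 2 * (2⁻¹ * a) := by
        rw [← mul_assoc, ENNReal.mul_inv_cancel (by simp) (by simp), one_mul]
    _ ≤ 2 * b := mul_le_mul' le_rfl h3

/-- The single-cube estimate behind the Carleson embedding. -/
lemma volume_rpow_mul_le_of_one_lt_laverage {n : ℕ} {p q : ℝ} (hp : 0 < p) (hpq : p ≤ q)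
    {c : ℝ≥0} {Φ : ℝ≥0 → ℝ≥0∞} (hΦ : Monotone Φ) (hΦc : Φ c ≤ 2⁻¹) (Q : Cube n)
    {h : (Fin n → ℝ) → ℝ≥0} (hh : AEMeasurable h) {l : ℝ≥0} (hl : 0 < l)
    (hav : 1 < ⨍⁻ x in Q.toSet, Φ (h x / l) ∂volume) :
    volume Q.toSet ^ (q / p) * (l : ℝ≥0∞) ^ q ≤
      2 ^ (q / p) * (∫⁻ x, (h x : ℝ≥0∞) ^ p) ^ (q / p - 1) *
        ∫⁻ x in Q.toSet, (h x : ℝ≥0∞) ^ p * bumpKernel p q c Φ (h x / l) := by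
  have hq : 0 < q := hp.trans_le hpq
  have hr1 : 1 ≤ q / p := (one_le_div hp).mpr hpq
  have hr : 0 < q / p := by positivity
  set κ := bumpKernel p q c Φ with hκ
  have hκm : Measurable κ := measurable_bumpKernel p q c hΦ
  -- Chosen so that h^p v = Φ(h/l) wherever h/l > c, while v^{q/p} = l^{-q} κ(h/l).
  set v : (Fin n → ℝ) → ℝ≥0∞ := fun x => ((l : ℝ≥0∞) ^ p)⁻¹ * κ (h x / l) ^ (p / q) with hv
  have hhr : AEMeasurable (fun x => ((h x : ℝ) / l)) (volume.restrict Q.toSet) :=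
    hh.restrict.coe_nnreal_real.div_const _
  have hu : AEMeasurable (fun x => (h x : ℝ≥0∞) ^ p) (volume.restrict Q.toSet) :=
    hh.restrict.coe_nnreal_ennreal.pow_const _
  have hκh : AEMeasurable (fun x => κ (h x / l)) (volume.restrict Q.toSet) :=
    hκm.comp_aemeasurable hhr
  have hvm : AEMeasurable v (volume.restrict Q.toSet) := (hκh.pow_const _).const_mul _
  -- Below the cut-off Φ(h/l) ≤ Φ(c) ≤ 1/2, which is absorbed when averaging because the average of
  -- Φ(h/l) exceeds 1.
  have hpt : ∀ x, Φ (h x / l) ≤ 2⁻¹ + (h x : ℝ≥0∞) ^ p * v x := by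
    intro x
    by_cases hx : h x / l ≤ c
    · exact ((hΦ hx).trans hΦc).trans le_self_add
    · rw [not_le] at hx
      have hx' : (c : ℝ) < (h x : ℝ) / l := by exact_mod_cast hx
      have hy0 : 0 < h x / l := lt_of_le_of_lt zero_le hx
      refine le_trans (le_of_eq ?_) le_add_self
      have e1 : ((h x : ℝ) / l).toNNReal = h x / l := by
        rw [← NNReal.coe_div, Real.toNNReal_coe]
      have e2 : ENNReal.ofReal (((h x : ℝ) / l) ^ q) = ((h x / l : ℝ≥0) : ℝ≥0∞) ^ q := by
        rw [← NNReal.coe_div, ← ENNReal.ofReal_rpow_of_nonneg (NNReal.coe_nonneg _) hq.le,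
          ENNReal.ofReal_coe_nnreal]
      have e3 : κ (h x / l) = Φ (h x / l) ^ (q / p) / ((h x / l : ℝ≥0) : ℝ≥0∞) ^ q := by
        rw [hκ, bumpKernel, if_pos hx', e1, e2]
      have e4 : κ (h x / l) ^ (p / q) = Φ (h x / l) / ((h x / l : ℝ≥0) : ℝ≥0∞) ^ p := by
        rw [e3, ENNReal.div_rpow_of_nonneg _ _ (by positivity), ← ENNReal.rpow_mul,
          ← ENNReal.rpow_mul]
        congr 1
        · rw [show q / p * (p / q) = 1 by field_simp, ENNReal.rpow_one]
        · congr 1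
          field_simp
      have e5 : (h x : ℝ≥0∞) ^ p * ((l : ℝ≥0∞) ^ p)⁻¹ = ((h x / l : ℝ≥0) : ℝ≥0∞) ^ p := by
        rw [ENNReal.coe_div hl.ne', ENNReal.div_rpow_of_nonneg _ _ hp.le, div_eq_mul_inv]
      have e6 : ((h x / l : ℝ≥0) : ℝ≥0∞) ^ p ≠ 0 := by
        refine (ENNReal.rpow_pos ?_ ENNReal.coe_ne_top).ne'
        exact_mod_cast hy0
      have e7 : ((h x / l : ℝ≥0) : ℝ≥0∞) ^ p ≠ ∞ :=
        (ENNReal.rpow_lt_top_of_nonneg hp.le ENNReal.coe_ne_top).ne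
      simp only [hv]
      rw [← mul_assoc, e5, e4, ENNReal.mul_div_cancel e6 e7]
  have hvol : volume Q.toSet ≤ 2 * ∫⁻ x in Q.toSet, (h x : ℝ≥0∞) ^ p * v x := by
    refine le_two_mul_of_le_half_add Q.volume_ne_top ?_
    rw [setLAverage_eq_inv_mul, ← ENNReal.div_eq_inv_mul,
      ENNReal.lt_div_iff_mul_lt (Or.inl Q.volume_ne_zero) (Or.inl Q.volume_ne_top), one_mul] at hav
    refine hav.le.trans ((lintegral_mono hpt).trans (le_of_eq ?_))
    rw [lintegral_add_left measurable_const, setLIntegral_const]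
  have hvr : ∀ x, v x ^ (q / p) = ((l : ℝ≥0∞) ^ q)⁻¹ * κ (h x / l) := by
    intro x
    simp only [hv]
    rw [ENNReal.mul_rpow_of_nonneg _ _ hr.le, ENNReal.inv_rpow, ← ENNReal.rpow_mul,
      ← ENNReal.rpow_mul, show p / q * (q / p) = 1 by field_simp, ENNReal.rpow_one,
      show p * (q / p) = q by field_simp]
  have hlq0 : (l : ℝ≥0∞) ^ q ≠ 0 := by
    simp [ENNReal.rpow_eq_zero_iff, hl.ne', hq.not_gt]
  have hlq1 : (l : ℝ≥0∞) ^ q ≠ ∞ := (ENNReal.rpow_lt_top_of_nonneg hq.le ENNReal.coe_ne_top).ne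
  have hint : ∫⁻ x in Q.toSet, (h x : ℝ≥0∞) ^ p * v x ^ (q / p) =
      ((l : ℝ≥0∞) ^ q)⁻¹ * ∫⁻ x in Q.toSet, (h x : ℝ≥0∞) ^ p * κ (h x / l) := by
    have e := lintegral_const_mul'' ((l : ℝ≥0∞) ^ q)⁻¹ (hu.mul hκh)
    simp only [Pi.mul_apply] at e
    rw [← e]
    refine lintegral_congr fun x => ?_
    rw [hvr x, mul_left_comm]
  calc volume Q.toSet ^ (q / p) * (l : ℝ≥0∞) ^ q
      ≤ (2 * ∫⁻ x in Q.toSet, (h x : ℝ≥0∞) ^ p * v x) ^ (q / p) * (l : ℝ≥0∞) ^ q :=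
        mul_le_mul' (ENNReal.rpow_le_rpow hvol hr.le) le_rfl
    _ ≤ 2 ^ (q / p) * ((∫⁻ x in Q.toSet, (h x : ℝ≥0∞) ^ p) ^ (q / p - 1) *
          (((l : ℝ≥0∞) ^ q)⁻¹ * ∫⁻ x in Q.toSet, (h x : ℝ≥0∞) ^ p * κ (h x / l))) *
          (l : ℝ≥0∞) ^ q := by
        rw [ENNReal.mul_rpow_of_nonneg _ _ hr.le, ← hint]
        exact mul_le_mul' (mul_le_mul' le_rfl (lintegral_mul_rpow_le hu hvm hr1)) le_rfl
    _ = 2 ^ (q / p) * (∫⁻ x in Q.toSet, (h x : ℝ≥0∞) ^ p) ^ (q / p - 1) *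
          (∫⁻ x in Q.toSet, (h x : ℝ≥0∞) ^ p * κ (h x / l)) *
          (((l : ℝ≥0∞) ^ q)⁻¹ * (l : ℝ≥0∞) ^ q) := by ring
    _ ≤ _ := by
        rw [ENNReal.inv_mul_cancel hlq0 hlq1, mul_one]
        -- Only the factor with exponent q/p - 1 ≥ 0 is enlarged to the whole space; the other
        -- integral stays on Q so that it can be summed over cubes.
        refine mul_le_mul' (mul_le_mul' le_rfl ?_) le_rfl
        exact ENNReal.rpow_le_rpow (setLIntegral_le_lintegral _ _) (by linarith)

lemma one_lt_laverage_of_lt_luxAvg {n : ℕ} {Φ : ℝ≥0 → ℝ≥0∞} {Q : Cube n}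
    {h : (Fin n → ℝ) → ℝ≥0} {l : ℝ≥0} (hl : 0 < l) (hlt : (l : ℝ≥0∞) < luxAvg Φ Q h) :
    1 < ⨍⁻ x in Q.toSet, Φ (h x / l) ∂volume := by
  by_contra hle
  exact absurd hlt (not_lt.mpr (iInf₂_le l ⟨hl, not_lt.mp hle⟩))

/-- The Carleson embedding `∑ |Q|^{q/p} ‖h‖_{Φ,Q}^q ≲ (∫ h^p)^{q/p}` for `Φ ∈ B_{p,q}`. -/
lemma exists_carleson_embedding {n : ℕ} {η : ℝ} (hη : 0 < η) {S D : Set (Cube n)}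
    (hD : IsDyadicLattice D) (hSD : S ⊆ D) (hS : IsEtaSparse η S) {p q : ℝ} (hp : 0 < p)
    (hpq : p ≤ q) {Φ : ℝ≥0 → ℝ≥0∞} (hΦ : Monotone Φ) (hΦ1 : Φ 1 ≠ ∞)
    (hΦc : ∃ c, 0 < c ∧ Φ c ≤ 2⁻¹) (hB : MemBpq p q Φ) :
    ∃ C : ℝ≥0∞, C ≠ ∞ ∧ ∀ h : (Fin n → ℝ) → ℝ≥0, AEMeasurable h →
      ∫⁻ x, (h x : ℝ≥0∞) ^ p ≠ ∞ → ∀ F : Finset (Cube n), (∀ Q ∈ F, Q ∈ S) →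
      ∑ Q ∈ F, volume Q.toSet ^ (q / p) * luxAvg Φ Q h ^ q ≤
        C * (∫⁻ x, (h x : ℝ≥0∞) ^ p) ^ (q / p) := by
  obtain ⟨c, hc, hΦc⟩ := hΦc
  have hq : 0 < q := hp.trans_le hpq
  have hr1 : 1 ≤ q / p := (one_le_div hp).mpr hpq
  have hr : 0 < q / p := by positivity
  have hδ : 0 ≤ 1 / p - 1 / q := sub_nonneg.mpr (one_div_le_one_div_of_le hp hpq)
  set C : ℝ≥0∞ := ENNReal.ofReal q * (ENNReal.ofReal η)⁻¹ * 2 ^ (q / p) *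
    ∫⁻ s in Ioi (0 : ℝ), bumpKernel p q c Φ s / ENNReal.ofReal s with hC
  have hη0 : ENNReal.ofReal η ≠ 0 := by simpa using hη
  have hCtop : C ≠ ∞ := by
    refine ENNReal.mul_ne_top (ENNReal.mul_ne_top (ENNReal.mul_ne_top ENNReal.ofReal_ne_top
      (ENNReal.inv_ne_top.mpr hη0)) ?_) (lintegral_bumpKernel_lt_top hp hpq hc hΦ hΦ1 hB).ne
    exact (ENNReal.rpow_lt_top_of_nonneg hr.le (by simp)).ne
  refine ⟨C, hCtop, fun h hh hfin => ?_⟩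
  -- The height a Q = l|Q|^δ with δ = 1/p - 1/q satisfies |Q| a(Q)^q = |Q|^{q/p} l^q, which puts the
  -- sum in layer-cake form.
  have hpow : ∀ Q : Cube n, ∀ l : ℝ≥0,
      volume Q.toSet * ENNReal.ofReal (((l : ℝ) * (volume Q.toSet).toReal ^ (1 / p - 1 / q)) ^ q) =
        volume Q.toSet ^ (q / p) * (l : ℝ≥0∞) ^ q := by
    intro Q l
    have hV := Q.toReal_volume_pos
    have e : ((l : ℝ) * (volume Q.toSet).toReal ^ (1 / p - 1 / q)) ^ q =
        (volume Q.toSet).toReal ^ (q / p - 1) * (l : ℝ) ^ q := by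
      rw [Real.mul_rpow (by positivity) (by positivity), ← Real.rpow_mul hV.le, mul_comm,
        show (1 / p - 1 / q) * q = q / p - 1 by field_simp]
    rw [e, ENNReal.ofReal_mul (by positivity), ← ENNReal.ofReal_rpow_of_pos hV,
      ← ENNReal.ofReal_rpow_of_nonneg (NNReal.coe_nonneg _) hq.le,
      ENNReal.ofReal_toReal Q.volume_ne_top, ENNReal.ofReal_coe_nnreal, ← mul_assoc]
    congr 1
    nth_rewrite 1 [← ENNReal.rpow_one (volume Q.toSet)]
    rw [← ENNReal.rpow_add _ _ Q.volume_ne_zero Q.volume_ne_top]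
    congr 1
    ring
  -- Luxemburg averages are not yet known to be finite, so the bound is first proved for finite
  -- minorants l Q.
  have key : ∀ F : Finset (Cube n), (∀ Q ∈ F, Q ∈ S) → ∀ l : Cube n → ℝ≥0,
      (∀ Q ∈ F, (l Q : ℝ≥0∞) ≤ luxAvg Φ Q h) →
      ∑ Q ∈ F, volume Q.toSet ^ (q / p) * (l Q : ℝ≥0∞) ^ q ≤
        C * (∫⁻ x, (h x : ℝ≥0∞) ^ p) ^ (q / p) := by
    intro F hF l hl
    have := hS.sum_le_of_forall_height hη hD hSD F hF
      (a := fun Q => (l Q : ℝ) * (volume Q.toSet).toReal ^ (1 / p - 1 / q))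
      (fun Q _ => by positivity) hδ hq (measurable_bumpKernel p q c hΦ)
      (by simp [bumpKernel]) hh (u := fun x => (h x : ℝ≥0∞) ^ p)
      (hh.coe_nnreal_ennreal.pow_const p)
      (2 ^ (q / p) * (∫⁻ x, (h x : ℝ≥0∞) ^ p) ^ (q / p - 1)) ?_
    · simp only [hpow] at this
      refine this.trans (le_of_eq ?_)
      have hsucc : (∫⁻ x, (h x : ℝ≥0∞) ^ p) ^ (q / p) =
          (∫⁻ x, (h x : ℝ≥0∞) ^ p) ^ (q / p - 1) * ∫⁻ x, (h x : ℝ≥0∞) ^ p := by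
        nth_rewrite 3 [← ENNReal.rpow_one (∫⁻ x, (h x : ℝ≥0∞) ^ p)]
        rw [← ENNReal.rpow_add_of_nonneg _ _ (by linarith) zero_le_one, sub_add_cancel]
      rw [hsucc, hC]
      ring
    · intro Q hQ t ht htl
      have hV := Q.toReal_volume_pos
      have hVδ : 0 < (volume Q.toSet).toReal ^ (1 / p - 1 / q) := Real.rpow_pos_of_pos hV _
      -- The Luxemburg level corresponding to the height t; it lies strictly below l Q, so the
      -- average of Φ(h/k) exceeds 1.
      set k : ℝ≥0 := ⟨t / (volume Q.toSet).toReal ^ (1 / p - 1 / q), by positivity⟩ with hk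
      have hkt : (k : ℝ) * (volume Q.toSet).toReal ^ (1 / p - 1 / q) = t :=
        div_mul_cancel₀ _ hVδ.ne'
      have hk0 : 0 < k := by
        rw [← NNReal.coe_pos]
        exact div_pos ht hVδ
      have hkl : k < l Q := by
        rw [← NNReal.coe_lt_coe]
        exact (div_lt_iff₀ hVδ).mpr htl
      have := volume_rpow_mul_le_of_one_lt_laverage hp hpq hΦ hΦc Q hh hk0
        (one_lt_laverage_of_lt_luxAvg hk0 ((ENNReal.coe_lt_coe.mpr hkl).trans_le (hl Q hQ)))
      rw [← hpow Q k, hkt] at this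
      refine this.trans (le_of_eq ?_)
      congr 1
      refine lintegral_congr fun x => ?_
      congr 2
      rw [← hkt]
      have : (k : ℝ) ≠ 0 := by exact_mod_cast hk0.ne'
      field_simp
  -- If the average were infinite, `key` on the single cube Q would allow arbitrarily large l;
  -- taking l^q = M + 1, with M the bound it gives for l^q, is contradictory.
  have htop : ∀ Q ∈ S, luxAvg Φ Q h ≠ ∞ := by
    intro Q hQ hinf
    have hv0 : volume Q.toSet ^ (q / p) ≠ 0 := by
      simp [ENNReal.rpow_eq_zero_iff, Q.volume_ne_zero, hr.not_gt]
    have hfin' : C * (∫⁻ x, (h x : ℝ≥0∞) ^ p) ^ (q / p) / volume Q.toSet ^ (q / p) ≠ ∞ :=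
      (ENNReal.div_lt_top (ENNReal.mul_ne_top hCtop
        (ENNReal.rpow_lt_top_of_nonneg hr.le hfin).ne) hv0).ne
    lift C * (∫⁻ x, (h x : ℝ≥0∞) ^ p) ^ (q / p) / volume Q.toSet ^ (q / p) to ℝ≥0
      using hfin' with M hM
    have := key {Q} (by simpa using hQ) (fun _ => (M + 1) ^ (1 / q)) (by simp [hinf])
    rw [Finset.sum_singleton, mul_comm, ← ENNReal.le_div_iff_mul_le (Or.inl hv0) (Or.inl
      (ENNReal.rpow_lt_top_of_nonneg hr.le Q.volume_ne_top).ne), ← hM,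
      ← ENNReal.coe_rpow_of_nonneg _ hq.le, ← NNReal.rpow_mul, one_div_mul_cancel hq.ne',
      NNReal.rpow_one] at this
    have h1 : M + 1 ≤ M := by exact_mod_cast this
    exact absurd h1 (not_le.mpr (lt_add_one M))
  intro F hF
  refine le_trans (Finset.sum_le_sum fun Q hQ => ?_)
    (key F hF (fun Q => (luxAvg Φ Q h).toNNReal) fun Q hQ => ENNReal.coe_toNNReal_le_self)
  rw [ENNReal.coe_toNNReal (htop Q (hF Q hQ))]

/-! ### Young functions and Hölder's inequality for Orlicz averages -/

lemma complementary_mono (A : ℝ≥0 → ℝ≥0) : Monotone (complementary A) := by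
  intro t t' h
  refine iSup₂_mono fun s _ => tsub_le_tsub_right ?_ _
  exact_mod_cast mul_le_mul' le_rfl h

/-- By superlinearity A(s) ≥ s beyond some s₀, so s - A(s) is positive only for s < s₀ and is at
most s₀. -/
lemma IsYoung.complementary_one_ne_top {A : ℝ≥0 → ℝ≥0} (hA : IsYoung A) :
    complementary A 1 ≠ ∞ := by
  obtain ⟨s₀, hs₀⟩ := (tendsto_atTop.mp hA.superlinear 1).exists_forall_of_atTop
  refine ne_top_of_le_ne_top (ENNReal.coe_ne_top (r := s₀)) (iSup₂_le fun s hs => ?_)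
  rw [mul_one, ← ENNReal.coe_sub, ENNReal.coe_le_coe]
  rcases le_total s s₀ with h | h
  · exact tsub_le_self.trans h
  · have := hs₀ s h
    rw [le_div_iff₀ hs, one_mul] at this
    rw [tsub_eq_zero_of_le this]
    exact zero_le

/-- For c ≤ 1 one has cs - A(s) ≤ c(s - A(s)). This linear decay at the origin supplies the cut-off
c of the bump kernel. -/
lemma complementary_le_mul (A : ℝ≥0 → ℝ≥0) {c : ℝ≥0} (hc : c ≤ 1) :
    complementary A c ≤ c * complementary A 1 := by
  refine iSup₂_le fun s hs => ?_
  have h1 : ((s * 1 : ℝ≥0) : ℝ≥0∞) - A s ≤ complementary A 1 := le_iSup₂_of_le s hs le_rfl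
  refine le_trans ?_ (mul_le_mul' le_rfl h1)
  rw [ENNReal.mul_sub (by simp)]
  have h2 : (c : ℝ≥0∞) * A s ≤ A s := mul_le_of_le_one_left zero_le (by exact_mod_cast hc)
  refine tsub_le_tsub (le_of_eq ?_) h2
  rw [mul_one, ENNReal.coe_mul, mul_comm]

lemma IsYoung.exists_complementary_le_half {A : ℝ≥0 → ℝ≥0} (hA : IsYoung A) :
    ∃ c, 0 < c ∧ complementary A c ≤ 2⁻¹ := by
  have hfin := hA.complementary_one_ne_top
  lift complementary A 1 to ℝ≥0 using hfin with M hM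
  have h0 : (0 : ℝ≥0) < 2 * (M + 1) := by positivity
  refine ⟨(2 * (M + 1))⁻¹, inv_pos.mpr h0, ?_⟩
  have h1 : (2 * (M + 1))⁻¹ ≤ (1 : ℝ≥0) := by
    refine inv_le_one_of_one_le₀ ?_
    calc (1 : ℝ≥0) ≤ 2 * 1 := by norm_num
      _ ≤ 2 * (M + 1) := by gcongr; exact le_add_self
  refine (complementary_le_mul A h1).trans ?_
  rw [← hM, ← ENNReal.coe_mul, show (2⁻¹ : ℝ≥0∞) = ((2⁻¹ : ℝ≥0) : ℝ≥0∞) by simp,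
    ENNReal.coe_le_coe, mul_inv, mul_assoc]
  refine mul_le_of_le_one_right zero_le ?_
  rw [inv_mul_le_iff₀ (by positivity), mul_one]
  exact le_self_add

/-- Young's inequality. -/
lemma mul_le_extendTop_add_complementary (A : ℝ≥0 → ℝ≥0) (u : ℝ≥0∞) (t : ℝ≥0) :
    u * t ≤ extendTop A u + complementary A t := by
  unfold extendTop
  split_ifs with hu
  · simp
  · lift u to ℝ≥0 using hu
    rcases eq_or_ne u 0 with rfl | h0
    · simp
    · rw [ENNReal.toNNReal_coe, add_comm, ← tsub_le_iff_right, ← ENNReal.coe_mul]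
      exact le_iSup₂_of_le u (pos_iff_ne_zero.mpr h0) le_rfl

lemma le_extendTop_add (A : ℝ≥0 → ℝ≥0) (u : ℝ≥0∞) :
    u ≤ extendTop A u + complementary A 1 := by
  simpa using mul_le_extendTop_add_complementary A u 1

lemma le_add_complementary (A : ℝ≥0 → ℝ≥0) (t : ℝ≥0) :
    (t : ℝ≥0∞) ≤ A 1 + complementary A t := by
  simpa [extendTop] using mul_le_extendTop_add_complementary A 1 t

lemma laverage_mono_fun {X : Type*} [MeasurableSpace X] {μ : Measure X} {f g : X → ℝ≥0∞}
    (h : ∀ x, f x ≤ g x) : ⨍⁻ x, f x ∂μ ≤ ⨍⁻ x, g x ∂μ := lintegral_mono h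

lemma Cube.laverage_const_mul {n : ℕ} (Q : Cube n) {c : ℝ≥0∞} (hc : c ≠ ∞)
    (f : (Fin n → ℝ) → ℝ≥0∞) :
    ⨍⁻ x in Q.toSet, c * f x ∂volume = c * ⨍⁻ x in Q.toSet, f x ∂volume :=
  lintegral_const_mul' _ _ hc

/-- Measurability is asked only of the second summand, so no measurability of `extendTop A` composed
with g is ever needed. -/
lemma Cube.laverage_add_right {n : ℕ} (Q : Cube n) (f : (Fin n → ℝ) → ℝ≥0∞)
    {g : (Fin n → ℝ) → ℝ≥0∞} (hg : AEMeasurable g (volume.restrict Q.toSet)) :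
    ⨍⁻ x in Q.toSet, (f x + g x) ∂volume =
      (⨍⁻ x in Q.toSet, f x ∂volume) + ⨍⁻ x in Q.toSet, g x ∂volume :=
  lintegral_add_right' _ (hg.smul_measure _)

lemma Cube.laverage_const {n : ℕ} (Q : Cube n) (c : ℝ≥0∞) :
    ⨍⁻ _ in Q.toSet, c ∂volume = c :=
  setLAverage_const Q.volume_ne_zero Q.volume_ne_top c

lemma Cube.lintegral_eq_mul_laverage {n : ℕ} (Q : Cube n) (f : (Fin n → ℝ) → ℝ≥0∞) :
    ∫⁻ x in Q.toSet, f x = volume Q.toSet * ⨍⁻ x in Q.toSet, f x ∂volume := by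
  rw [setLAverage_eq_inv_mul, ← mul_assoc,
    ENNReal.mul_inv_cancel Q.volume_ne_zero Q.volume_ne_top, one_mul]

/-- Young's inequality with t = 1, scaled by an admissible l. It shows that a zero Orlicz average
forces g = 0 a.e. and a finite one forces g < ∞ a.e. -/
lemma laverage_le_mul_orliczAvg {n : ℕ} {A : ℝ≥0 → ℝ≥0} (hA : IsYoung A) (Q : Cube n)
    (g : (Fin n → ℝ) → ℝ≥0∞) :
    ⨍⁻ x in Q.toSet, g x ∂volume ≤ (1 + complementary A 1) * orliczAvg A Q g := by
  have h1 : (1 + complementary A 1) ≠ 0 := by simp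
  have h2 : (1 + complementary A 1) ≠ ∞ := by simpa using hA.complementary_one_ne_top
  rw [mul_comm, ← ENNReal.div_le_iff h1 h2]
  refine le_iInf₂ fun l hl => ?_
  rw [ENNReal.div_le_iff h1 h2]
  have hl0 : (l : ℝ≥0∞) ≠ 0 := by simpa using hl.1.ne'
  calc ⨍⁻ x in Q.toSet, g x ∂volume
      ≤ ⨍⁻ x in Q.toSet, l * (extendTop A (g x / l) + complementary A 1) ∂volume := by
        refine laverage_mono_fun fun x => ?_
        rw [← ENNReal.div_le_iff' hl0 ENNReal.coe_ne_top]
        exact le_extendTop_add A _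
    _ ≤ l * (1 + complementary A 1) := by
        rw [Q.laverage_const_mul ENNReal.coe_ne_top, Q.laverage_add_right _ aemeasurable_const,
          Q.laverage_const]
        gcongr
        exact hl.2

lemma laverage_le_mul_luxAvg {n : ℕ} (A : ℝ≥0 → ℝ≥0) (Q : Cube n)
    (h : (Fin n → ℝ) → ℝ≥0) :
    ⨍⁻ x in Q.toSet, (h x : ℝ≥0∞) ∂volume ≤ (A 1 + 1) * luxAvg (complementary A) Q h := by
  have h1 : (A 1 + 1 : ℝ≥0∞) ≠ 0 := by simp
  have h2 : (A 1 + 1 : ℝ≥0∞) ≠ ∞ := by simp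
  rw [mul_comm, ← ENNReal.div_le_iff h1 h2]
  refine le_iInf₂ fun l hl => ?_
  rw [ENNReal.div_le_iff h1 h2]
  have hl0 : (l : ℝ≥0∞) ≠ 0 := by simpa using hl.1.ne'
  calc ⨍⁻ x in Q.toSet, (h x : ℝ≥0∞) ∂volume
      ≤ ⨍⁻ x in Q.toSet, l * (complementary A (h x / l) + A 1) ∂volume := by
        refine laverage_mono_fun fun x => ?_
        rw [← ENNReal.div_le_iff' hl0 ENNReal.coe_ne_top, ← ENNReal.coe_div hl.1.ne', add_comm]
        exact le_add_complementary A _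
    _ ≤ l * (A 1 + 1) := by
        rw [Q.laverage_const_mul ENNReal.coe_ne_top, Q.laverage_add_right _ aemeasurable_const,
          Q.laverage_const, add_comm]
        gcongr
        exact hl.2

lemma ae_eq_zero_of_laverage_eq_zero {n : ℕ} {Q : Cube n} {g : (Fin n → ℝ) → ℝ≥0∞}
    (hg : AEMeasurable g (volume.restrict Q.toSet)) (h : ⨍⁻ x in Q.toSet, g x ∂volume = 0) :
    g =ᵐ[volume.restrict Q.toSet] 0 := by
  rw [← lintegral_eq_zero_iff' hg, Q.lintegral_eq_mul_laverage, h, mul_zero]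

lemma ae_eq_zero_of_orliczAvg_eq_zero {n : ℕ} {A : ℝ≥0 → ℝ≥0} (hA : IsYoung A) {Q : Cube n}
    {g : (Fin n → ℝ) → ℝ≥0∞} (hg : AEMeasurable g (volume.restrict Q.toSet))
    (h : orliczAvg A Q g = 0) : g =ᵐ[volume.restrict Q.toSet] 0 := by
  refine ae_eq_zero_of_laverage_eq_zero hg (le_antisymm ?_ zero_le)
  simpa [h] using laverage_le_mul_orliczAvg hA Q g

lemma ae_lt_top_of_orliczAvg_ne_top {n : ℕ} {A : ℝ≥0 → ℝ≥0} (hA : IsYoung A) {Q : Cube n}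
    {g : (Fin n → ℝ) → ℝ≥0∞} (hg : AEMeasurable g (volume.restrict Q.toSet))
    (h : orliczAvg A Q g ≠ ∞) : ∀ᵐ x ∂volume.restrict Q.toSet, g x < ∞ := by
  refine ae_lt_top' hg ?_
  rw [Q.lintegral_eq_mul_laverage]
  refine ENNReal.mul_ne_top Q.volume_ne_top (ne_top_of_le_ne_top ?_
    (laverage_le_mul_orliczAvg hA Q g))
  exact ENNReal.mul_ne_top (by simpa using hA.complementary_one_ne_top) h

/-- Hölder's inequality for Orlicz averages. -/
lemma lintegral_mul_le_orliczAvg_mul_luxAvg {n : ℕ} {A : ℝ≥0 → ℝ≥0} (hA : IsYoung A)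
    (Q : Cube n) {g : (Fin n → ℝ) → ℝ≥0∞} (hg : AEMeasurable g (volume.restrict Q.toSet))
    {h : (Fin n → ℝ) → ℝ≥0} (hh : AEMeasurable h (volume.restrict Q.toSet)) :
    ∫⁻ x in Q.toSet, g x * h x ≤
      2 * volume Q.toSet * (orliczAvg A Q g * luxAvg (complementary A) Q h) := by
  set N := orliczAvg A Q g with hN
  set M := luxAvg (complementary A) Q h with hM
  have hle : ∀ l : ℝ≥0, 0 < l → ⨍⁻ x in Q.toSet, extendTop A (g x / l) ∂volume ≤ 1 →
      ∀ k : ℝ≥0, 0 < k → ⨍⁻ x in Q.toSet, complementary A (h x / k) ∂volume ≤ 1 →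
      ∫⁻ x in Q.toSet, g x * h x ≤ 2 * volume Q.toSet * (l * k) := by
    intro l hl hl1 k hk hk1
    have hl0 : (l : ℝ≥0∞) ≠ 0 := by simpa using hl.ne'
    have hk0 : (k : ℝ≥0∞) ≠ 0 := by simpa using hk.ne'
    have hmeas : AEMeasurable (fun x => complementary A (h x / k)) (volume.restrict Q.toSet) :=
      (complementary_mono A).measurable.comp_aemeasurable (hh.div_const _)
    have : ⨍⁻ x in Q.toSet, g x * h x ∂volume ≤ (l * k) * 2 := by
      calc ⨍⁻ x in Q.toSet, g x * h x ∂volume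
          ≤ ⨍⁻ x in Q.toSet, (l * k : ℝ≥0∞) *
              (extendTop A (g x / l) + complementary A (h x / k)) ∂volume := by
            refine laverage_mono_fun fun x => ?_
            refine le_trans (le_of_eq ?_)
              (mul_le_mul' le_rfl (mul_le_extendTop_add_complementary A (g x / l) (h x / k)))
            rw [ENNReal.coe_div hk.ne']
            calc g x * h x = (l * (g x / l)) * (k * (h x / k)) := by
                  rw [ENNReal.mul_div_cancel hl0 ENNReal.coe_ne_top,
                    ENNReal.mul_div_cancel hk0 ENNReal.coe_ne_top]
              _ = _ := by ring
        _ ≤ (l * k) * 2 := by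
            rw [Q.laverage_const_mul (ENNReal.mul_ne_top ENNReal.coe_ne_top ENNReal.coe_ne_top),
              Q.laverage_add_right _ hmeas, ← one_add_one_eq_two]
            gcongr
    rw [Q.lintegral_eq_mul_laverage]
    refine (mul_le_mul' le_rfl this).trans (le_of_eq (by ring))
  -- The convention 0 · ∞ = 0 makes the right side vanish if either average is zero, even when the
  -- other is infinite, so the left side must be shown to be zero.
  by_cases hN0 : N = 0
  · have h0 := ae_eq_zero_of_orliczAvg_eq_zero hA hg hN0
    refine le_trans (le_of_eq ?_) zero_le
    refine lintegral_eq_zero_of_ae_eq_zero ?_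
    filter_upwards [h0] with x hx
    simp [hx]
  by_cases hM0 : M = 0
  · have h0 : (fun x => (h x : ℝ≥0∞)) =ᵐ[volume.restrict Q.toSet] 0 := by
      refine ae_eq_zero_of_laverage_eq_zero hh.coe_nnreal_ennreal (le_antisymm ?_ zero_le)
      have := laverage_le_mul_luxAvg A Q h
      rwa [← hM, hM0, mul_zero] at this
    refine le_trans (le_of_eq ?_) zero_le
    refine lintegral_eq_zero_of_ae_eq_zero ?_
    filter_upwards [h0] with x hx
    have hx : (h x : ℝ≥0∞) = 0 := hx
    simp [hx]
  have h2v : 2 * volume Q.toSet ≠ 0 := mul_ne_zero (by simp) Q.volume_ne_zero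
  have h2v' : 2 * volume Q.toSet ≠ ∞ := ENNReal.mul_ne_top (by simp) Q.volume_ne_top
  by_cases hNt : N = ∞
  · simp [hNt, hM0, Q.volume_ne_zero]
  by_cases hMt : M = ∞
  · simp [hMt, hN0, Q.volume_ne_zero]
  -- The two infima are taken one after the other, k first, dividing each time by a factor that is
  -- neither 0 nor ∞.
  have step : ∀ l : ℝ≥0, 0 < l → ⨍⁻ x in Q.toSet, extendTop A (g x / l) ∂volume ≤ 1 →
      ∫⁻ x in Q.toSet, g x * h x ≤ 2 * volume Q.toSet * (l * M) := by
    intro l hl hl1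
    have hl0 : 2 * volume Q.toSet * l ≠ 0 := mul_ne_zero h2v (by simpa using hl.ne')
    have hlt : 2 * volume Q.toSet * l ≠ ∞ := ENNReal.mul_ne_top h2v' ENNReal.coe_ne_top
    rw [← mul_assoc, ← ENNReal.div_le_iff' hl0 hlt]
    refine le_iInf₂ fun k hk => ?_
    rw [ENNReal.div_le_iff' hl0 hlt, mul_assoc]
    exact hle l hl hl1 k hk.1 hk.2
  have hM1 : 2 * volume Q.toSet * M ≠ 0 := mul_ne_zero h2v hM0
  have hM2 : 2 * volume Q.toSet * M ≠ ∞ := ENNReal.mul_ne_top h2v' hMt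
  rw [mul_comm N, ← mul_assoc, ← ENNReal.div_le_iff' hM1 hM2]
  refine le_iInf₂ fun l hl => ?_
  rw [ENNReal.div_le_iff' hM1 hM2, mul_assoc, mul_comm M]
  exact step l hl.1 hl.2

/-! ### Duality in weighted Lebesgue spaces -/

lemma IsWeight.aemeasurable {n : ℕ} {w : (Fin n → ℝ) → ℝ} (hw : IsWeight w) :
    AEMeasurable w :=
  hw.locallyIntegrable.aestronglyMeasurable.aemeasurable

lemma IsWeight.setLIntegral_lt_top {n : ℕ} {w : (Fin n → ℝ) → ℝ} (hw : IsWeight w)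
    {K : Set (Fin n → ℝ)} (hK : IsCompact K) : ∫⁻ x in K, ENNReal.ofReal (w x) < ∞ :=
  (hw.locallyIntegrable.integrableOn_isCompact hK).lintegral_lt_top

lemma weightedNorm_mono {n : ℕ} {r : ℝ} (hr : 0 ≤ r) (w : (Fin n → ℝ) → ℝ)
    {g g' : (Fin n → ℝ) → ℝ≥0∞} (h : ∀ x, g x ≤ g' x) :
    weightedNorm r w g ≤ weightedNorm r w g' :=
  ENNReal.rpow_le_rpow (lintegral_mono fun x =>
    mul_le_mul' (ENNReal.rpow_le_rpow (h x) hr) le_rfl) (by positivity)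

lemma rpow_le_of_le_mul_rpow {X C : ℝ≥0∞} {r s : ℝ} (hr : 0 < r) (hrs : r + s = 1)
    (hX : X ≠ ∞) (h : X ≤ C * X ^ s) : X ^ r ≤ C := by
  rcases eq_or_ne X 0 with rfl | h0
  · simp [ENNReal.zero_rpow_of_pos hr]
  · have e : X = X ^ r * X ^ s := by
      rw [← ENNReal.rpow_add _ _ h0 hX, hrs, ENNReal.rpow_one]
    nth_rewrite 1 [e] at h
    have h1 : X ^ s ≠ 0 := (ENNReal.rpow_pos (pos_iff_ne_zero.mpr h0) hX).ne'
    have h2 : X ^ s ≠ ∞ := ENNReal.rpow_ne_top_of_ne_zero h0 hX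
    exact (ENNReal.mul_le_mul_iff_left h1 h2).mp h

/-- The norm of `L^q(w)` is determined by pairing with functions in `L^{q'}(w)`. -/
lemma weightedNorm_le_of_forall_pairing {n : ℕ} {w : (Fin n → ℝ) → ℝ} (hw : IsWeight w)
    {q : ℝ} (hq : 1 < q) {F : (Fin n → ℝ) → ℝ≥0∞} (hF : AEMeasurable F) (C : ℝ≥0∞)
    (H : ∀ g : (Fin n → ℝ) → ℝ≥0, AEMeasurable g →
      ∫⁻ x, (g x : ℝ≥0∞) ^ Real.conjExponent q * ENNReal.ofReal (w x) ≠ ∞ →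
      ∫⁻ x, F x * (g x * ENNReal.ofReal (w x)) ≤ C *
        (∫⁻ x, (g x : ℝ≥0∞) ^ Real.conjExponent q * ENNReal.ofReal (w x)) ^
          (1 / Real.conjExponent q)) :
    weightedNorm q w F ≤ C := by
  have hq0 : 0 < q := by linarith
  have hconj : q.HolderConjugate (Real.conjExponent q) := Real.HolderConjugate.conjExponent hq
  have hq'0 : 0 < Real.conjExponent q := hconj.symm.pos
  have hmul : (q - 1) * Real.conjExponent q = q := hconj.sub_one_mul_conj
  have hwm : AEMeasurable fun x => ENNReal.ofReal (w x) := hw.aemeasurable.ennreal_ofReal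
  -- Truncation in height and space makes the L^q(w) norm finite, w being locally integrable;
  -- finiteness is what permits the division below.
  set T : ℕ → (Fin n → ℝ) → ℝ≥0∞ := fun k =>
    (Metric.closedBall 0 (k : ℝ)).indicator fun x => min (F x) k with hT
  have hTm : ∀ k, AEMeasurable (T k) := fun k =>
    (hF.min aemeasurable_const).indicator Metric.isClosed_closedBall.measurableSet
  have hTk : ∀ k x, T k x ≤ k := fun k x =>
    indicator_le (fun _ _ => min_le_right _ _) x
  have hTtop : ∀ k x, T k x ≠ ∞ := fun k x =>
    ne_top_of_le_ne_top (ENNReal.natCast_ne_top k) (hTk k x)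
  have hTF : ∀ k x, T k x ≤ F x := fun k x => indicator_le (fun _ _ => min_le_left _ _) x
  have hbound : ∀ k, (∫⁻ x, T k x ^ q * ENNReal.ofReal (w x)) ^ (1 / q) ≤ C := by
    intro k
    have hXfin : ∫⁻ x, T k x ^ q * ENNReal.ofReal (w x) ≠ ∞ := by
      have : ∫⁻ x, T k x ^ q * ENNReal.ofReal (w x) ≤
          ∫⁻ x in Metric.closedBall 0 (k : ℝ), (k : ℝ≥0∞) ^ q * ENNReal.ofReal (w x) := by
        rw [← lintegral_indicator Metric.isClosed_closedBall.measurableSet]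
        refine lintegral_mono fun x => ?_
        by_cases hx : x ∈ Metric.closedBall (0 : Fin n → ℝ) (k : ℝ)
        · rw [indicator_of_mem hx]
          exact mul_le_mul' (ENNReal.rpow_le_rpow (hTk k x) hq0.le) le_rfl
        · simp [hT, hx, hq0]
      refine ne_top_of_le_ne_top ?_ this
      have hkq : (k : ℝ≥0∞) ^ q ≠ ∞ :=
        (ENNReal.rpow_lt_top_of_nonneg hq0.le (ENNReal.natCast_ne_top k)).ne
      rw [lintegral_const_mul' _ _ hkq]
      exact ENNReal.mul_ne_top hkq (hw.setLIntegral_lt_top (isCompact_closedBall _ _)).ne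
    have hcoe : ∀ x, (((T k x).toNNReal ^ (q - 1) : ℝ≥0) : ℝ≥0∞) = T k x ^ (q - 1) := by
      intro x
      rw [ENNReal.coe_rpow_of_nonneg _ (by linarith), ENNReal.coe_toNNReal (hTtop k x)]
    have hpow : ∀ x, (((T k x).toNNReal ^ (q - 1) : ℝ≥0) : ℝ≥0∞) ^ Real.conjExponent q =
        T k x ^ q := by
      intro x
      rw [hcoe, ← ENNReal.rpow_mul, hmul]
    -- Testing with T_k^{q-1}, whose q'-th power is T_k^q, gives X ≤ C X^{1/q'} for X = ∫ T_k^q w.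
    have h1 := H (fun x => (T k x).toNNReal ^ (q - 1)) ((hTm k).ennreal_toNNReal.pow_const _)
    simp only [hpow] at h1
    simp only [hcoe] at h1
    refine rpow_le_of_le_mul_rpow (by positivity) ?_ hXfin (le_trans ?_ (h1 hXfin))
    · simpa only [one_div] using hconj.inv_add_inv_eq_one
    · refine lintegral_mono fun x => ?_
      rw [← mul_assoc]
      refine mul_le_mul' ?_ le_rfl
      calc T k x ^ q = T k x ^ (1 + (q - 1)) := by rw [add_sub_cancel]
        _ = T k x * T k x ^ (q - 1) := by
          rw [ENNReal.rpow_add_of_nonneg _ _ zero_le_one (by linarith), ENNReal.rpow_one]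
        _ ≤ F x * T k x ^ (q - 1) := mul_le_mul' (hTF k x) le_rfl
  have hlim : Tendsto (fun k => ∫⁻ x, T k x ^ q * ENNReal.ofReal (w x)) atTop
      (nhds (∫⁻ x, F x ^ q * ENNReal.ofReal (w x))) := by
    refine lintegral_tendsto_of_tendsto_of_monotone (fun k => ((hTm k).pow_const q).mul hwm)
      (ae_of_all _ fun x k l hkl => ?_) (ae_of_all _ fun x => ?_)
    · refine mul_le_mul' (ENNReal.rpow_le_rpow ?_ hq0.le) le_rfl
      have hkl' : (k : ℝ) ≤ l := by exact_mod_cast hkl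
      by_cases hx : x ∈ Metric.closedBall (0 : Fin n → ℝ) (k : ℝ)
      · simp only [hT, indicator_of_mem hx,
          indicator_of_mem (Metric.closedBall_subset_closedBall hkl' hx)]
        exact min_le_min_left _ (by exact_mod_cast hkl)
      · simp [hT, hx]
    · have hev : (fun k => T k x) =ᶠ[atTop] fun k => min (F x) (k : ℝ≥0∞) := by
        filter_upwards [eventually_ge_atTop ⌈‖x‖⌉₊] with k hk
        have : x ∈ Metric.closedBall (0 : Fin n → ℝ) (k : ℝ) := by
          simpa using Nat.ceil_le.mp hk
        simp only [hT, indicator_of_mem this]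
      have h1 : Tendsto (fun k : ℕ => min (F x) (k : ℝ≥0∞)) atTop (nhds (F x)) := by
        simpa using (tendsto_const_nhds (x := F x)).min ENNReal.tendsto_nat_nhds_top
      exact ENNReal.Tendsto.mul_const (((h1.congr' hev.symm).ennrpow_const q))
        (Or.inr ENNReal.ofReal_ne_top)
  exact le_of_tendsto (hlim.ennrpow_const (1 / q)) (Eventually.of_forall hbound)

/-! ### Sufficiency of the bump conditions -/

/-- A pair of Orlicz bumps controls the bilinear form of a single cube. -/
lemma lintegral_mul_lintegral_le_of_bump {n : ℕ} {A B : ℝ≥0 → ℝ≥0} (hA : IsYoung A)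
    (hB : IsYoung B) {p q a : ℝ} (hp : 0 < p) (hq : 1 < q) {μ ν : (Fin n → ℝ) → ℝ}
    (hμ : AEMeasurable μ) (hν : AEMeasurable ν) (Q : Cube n) {w w' : (Fin n → ℝ) → ℝ≥0∞}
    (hw : AEMeasurable w (volume.restrict Q.toSet))
    (hw' : AEMeasurable w' (volume.restrict Q.toSet)) {K : ℝ≥0∞} (hK : K ≠ ∞)
    (hbump : volume Q.toSet ^ (a + 1 / q - 1 / p) *
      orliczAvg A Q (fun x => w' x * wpow μ (1 / q) x) *
      orliczAvg B Q (fun x => w x * wpow ν (-(1 / p)) x) ≤ K)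
    {φ g : (Fin n → ℝ) → ℝ≥0} (hφ : AEMeasurable φ) (hg : AEMeasurable g) :
    ∫⁻ x, Q.toSet.indicator (fun x => volume Q.toSet ^ a * w' x *
        ⨍⁻ y in Q.toSet, w y * φ y ∂volume) x * (g x * ENNReal.ofReal (μ x)) ≤
      4 * K * ((volume Q.toSet ^ (1 / Real.conjExponent q) *
          luxAvg (complementary A) Q
            (fun x => g x * (μ x).toNNReal ^ (1 / Real.conjExponent q))) *
        (volume Q.toSet ^ (1 / p) *
          luxAvg (complementary B) Q (fun x => φ x * (ν x).toNNReal ^ (1 / p)))) := by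
  have hq0 : 0 < q := by linarith
  have hconj : q.HolderConjugate (Real.conjExponent q) := Real.HolderConjugate.conjExponent hq
  have hq' : 0 < Real.conjExponent q := hconj.symm.pos
  set V := volume Q.toSet with hV
  have hV0 : V ≠ 0 := Q.volume_ne_zero
  have hVt : V ≠ ∞ := Q.volume_ne_top
  set u₁ : (Fin n → ℝ) → ℝ≥0∞ := fun x => w' x * wpow μ (1 / q) x with hu₁
  set u₂ : (Fin n → ℝ) → ℝ≥0∞ := fun x => w x * wpow ν (-(1 / p)) x with hu₂
  set G : (Fin n → ℝ) → ℝ≥0 := fun x => g x * (μ x).toNNReal ^ (1 / Real.conjExponent q) with hG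
  set v : (Fin n → ℝ) → ℝ≥0 := fun x => φ x * (ν x).toNNReal ^ (1 / p) with hv
  have hGm : AEMeasurable G := hg.mul (hμ.real_toNNReal.pow_const _)
  have hvm : AEMeasurable v := hφ.mul (hν.real_toNNReal.pow_const _)
  have hu₁m : AEMeasurable u₁ (volume.restrict Q.toSet) :=
    hw'.mul (hμ.ennreal_ofReal.pow_const _).restrict
  have hu₂m : AEMeasurable u₂ (volume.restrict Q.toSet) :=
    hw.mul (hν.ennreal_ofReal.pow_const _).restrict
  set N₁ := orliczAvg A Q u₁ with hN₁
  set N₂ := orliczAvg B Q u₂ with hN₂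
  set M₁ := luxAvg (complementary A) Q G with hM₁
  set M₂ := luxAvg (complementary B) Q v with hM₂
  have hH₁ : ∫⁻ x in Q.toSet, u₁ x * G x ≤ 2 * V * (N₁ * M₁) :=
    lintegral_mul_le_orliczAvg_mul_luxAvg hA Q hu₁m hGm.restrict
  have hpt₁ : ∀ x, w' x * (g x * ENNReal.ofReal (μ x)) = u₁ x * G x := by
    intro x
    have e : ENNReal.ofReal (μ x) =
        ENNReal.ofReal (μ x) ^ (1 / q) * ENNReal.ofReal (μ x) ^ (1 / Real.conjExponent q) := by
      rw [← ENNReal.rpow_add_of_nonneg _ _ (by positivity) (by positivity)]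
      rw [one_div, one_div, hconj.inv_add_inv_eq_one, ENNReal.rpow_one]
    simp only [hu₁, hG, wpow, ENNReal.coe_mul]
    rw [ENNReal.coe_rpow_of_nonneg _ (by positivity : 0 ≤ 1 / Real.conjExponent q)]
    change _ = w' x * ENNReal.ofReal (μ x) ^ (1 / q) *
      (g x * ENNReal.ofReal (μ x) ^ (1 / Real.conjExponent q))
    nth_rewrite 1 [e]
    ring
  have hLHS : ∫⁻ x, Q.toSet.indicator (fun x => V ^ a * w' x *
        ⨍⁻ y in Q.toSet, w y * φ y ∂volume) x * (g x * ENNReal.ofReal (μ x)) =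
      (V ^ a * ⨍⁻ y in Q.toSet, w y * φ y ∂volume) * ∫⁻ x in Q.toSet, u₁ x * G x := by
    have hm : AEMeasurable (fun x => u₁ x * G x) (volume.restrict Q.toSet) :=
      hu₁m.mul hGm.restrict.coe_nnreal_ennreal
    rw [← lintegral_const_mul'' _ hm, ← lintegral_indicator Q.measurableSet_toSet]
    refine lintegral_congr fun x => ?_
    by_cases hx : x ∈ Q.toSet
    · simp only [indicator_of_mem hx]
      rw [← hpt₁]
      ring
    · simp [hx]
  rw [hLHS]
  -- An infinite second average is compatible with a finite bump constant only if the first is zero;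
  -- then the integral against g vanishes.
  by_cases hN₂t : N₂ = ∞
  · have hN₁0 : N₁ = 0 := by
      by_contra h0
      have hVe : V ^ (a + 1 / q - 1 / p) ≠ 0 :=
        (ENNReal.rpow_pos (pos_iff_ne_zero.mpr hV0) hVt).ne'
      rw [hN₂t, ENNReal.mul_top (mul_ne_zero hVe h0)] at hbump
      exact hK (top_le_iff.mp hbump)
    rw [hN₁0, zero_mul, mul_zero] at hH₁
    rw [le_antisymm hH₁ zero_le, mul_zero]
    exact zero_le
  have hfin : ∀ᵐ x ∂volume.restrict Q.toSet, u₂ x < ∞ :=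
    ae_lt_top_of_orliczAvg_ne_top hB hu₂m hN₂t
  have hH₂ : ∫⁻ x in Q.toSet, w x * φ x ≤ 2 * V * (N₂ * M₂) := by
    refine le_trans (lintegral_mono_ae ?_)
      (lintegral_mul_le_orliczAvg_mul_luxAvg hB Q hu₂m hvm.restrict)
    filter_upwards [hfin] with x hx
    have hp' : 0 < 1 / p := by positivity
    simp only [hv, ENNReal.coe_mul]
    rw [ENNReal.coe_rpow_of_nonneg _ hp'.le]
    change _ ≤ u₂ x * (φ x * ENNReal.ofReal (ν x) ^ (1 / p))
    simp only [hu₂, wpow] at hx ⊢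
    -- Where ν = 0 the factor ν^{-1/p} is ∞, so finiteness of w ν^{-1/p} forces w = 0 there;
    -- elsewhere the powers of ν cancel.
    rcases eq_or_ne (ENNReal.ofReal (ν x)) 0 with h0 | h0
    · have hw0 : w x = 0 := by
        by_contra hne
        rw [h0, ENNReal.zero_rpow_of_neg (by linarith), ENNReal.mul_top hne] at hx
        exact lt_irrefl _ hx
      simp [hw0]
    · have h1 : ENNReal.ofReal (ν x) ^ (-(1 / p)) * ENNReal.ofReal (ν x) ^ (1 / p) = 1 := by
        rw [← ENNReal.rpow_add _ _ h0 ENNReal.ofReal_ne_top, neg_add_cancel, ENNReal.rpow_zero]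
      refine le_of_eq ?_
      calc w x * φ x = w x * φ x *
            (ENNReal.ofReal (ν x) ^ (-(1 / p)) * ENNReal.ofReal (ν x) ^ (1 / p)) := by
              rw [h1, mul_one]
        _ = _ := by ring
  have hexp : V ^ a * V = V ^ (a + 1 / q - 1 / p) *
      (V ^ (1 / Real.conjExponent q) * V ^ (1 / p)) := by
    nth_rewrite 2 [← ENNReal.rpow_one V]
    rw [← ENNReal.rpow_add _ _ hV0 hVt, ← ENNReal.rpow_add _ _ hV0 hVt,
      ← ENNReal.rpow_add _ _ hV0 hVt]
    congr 1
    have := hconj.inv_add_inv_eq_one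
    simp only [one_div]
    linarith
  calc (V ^ a * ⨍⁻ y in Q.toSet, w y * φ y ∂volume) * ∫⁻ x in Q.toSet, u₁ x * G x
      ≤ (V ^ a * (V⁻¹ * (2 * V * (N₂ * M₂)))) * (2 * V * (N₁ * M₁)) := by
        rw [setLAverage_eq_inv_mul]
        gcongr
    _ = 4 * (V⁻¹ * V) * (V ^ a * V) * (N₁ * N₂) * (M₁ * M₂) := by ring
    _ = 4 * (V ^ (a + 1 / q - 1 / p) * N₁ * N₂) *
          ((V ^ (1 / Real.conjExponent q) * M₁) * (V ^ (1 / p) * M₂)) := by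
        rw [ENNReal.inv_mul_cancel hV0 hVt, hexp]
        ring
    _ ≤ _ := by gcongr

lemma memBpq_of_memB {r : ℝ} (hr : r ≠ 0) {Φ : ℝ≥0 → ℝ≥0∞} (h : MemB r Φ) : MemBpq r r Φ := by
  simpa only [MemBpq, MemB, div_self hr, ENNReal.rpow_one] using h

/-- A two-weight bound for sums over sparse families under Orlicz bump conditions. -/
lemma exists_weightedNorm_tsum_le {n : ℕ} {S : Set (Cube n)} (hS : IsSparse S)
    {A B : ℝ≥0 → ℝ≥0} (hA : IsYoung A) (hB : IsYoung B) {p q a : ℝ} (hp : 1 < p) (hpq : p ≤ q)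
    (hA' : MemB (Real.conjExponent q) (complementary A))
    (hB' : MemBpq p q (complementary B)) {μ ν : (Fin n → ℝ) → ℝ}
    (hμ : IsWeight μ) (hν : IsWeight ν) {w w' : Cube n → (Fin n → ℝ) → ℝ≥0∞}
    (hw : ∀ Q, AEMeasurable (w Q) (volume.restrict Q.toSet))
    (hw' : ∀ Q, AEMeasurable (w' Q) (volume.restrict Q.toSet))
    (hbump : ⨆ Q ∈ S, volume Q.toSet ^ (a + 1 / q - 1 / p) *
      orliczAvg A Q (fun x => w' Q x * wpow μ (1 / q) x) *
      orliczAvg B Q (fun x => w Q x * wpow ν (-(1 / p)) x) < ∞) :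
    ∃ K : ℝ≥0, ∀ φ : (Fin n → ℝ) → ℝ≥0, AEMeasurable φ →
      weightedNorm q μ (fun x => ∑' Q : S, Q.1.toSet.indicator (fun x =>
        volume Q.1.toSet ^ a * w' Q x * ⨍⁻ y in Q.1.toSet, w Q y * φ y ∂volume) x) ≤
      K * weightedNorm p ν (fun x => φ x) := by
  obtain ⟨D, hD, hSD, η, hη, -, hE⟩ := hS
  have hp0 : 0 < p := by linarith
  have hq1 : 1 < q := by linarith
  have hq0 : 0 < q := by linarith
  have hconj : q.HolderConjugate (Real.conjExponent q) := Real.HolderConjugate.conjExponent hq1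
  have hq' : 0 < Real.conjExponent q := hconj.symm.pos
  have : Countable S := (hE.countable hη).to_subtype
  obtain ⟨C₁, hC₁, hcarl₁⟩ := exists_carleson_embedding hη hD hSD hE hq' le_rfl
    (complementary_mono A) hA.complementary_one_ne_top hA.exists_complementary_le_half
    (memBpq_of_memB hq'.ne' hA')
  obtain ⟨C₂, hC₂, hcarl₂⟩ := exists_carleson_embedding hη hD hSD hE hp0 hpq
    (complementary_mono B) hB.complementary_one_ne_top hB.exists_complementary_le_half hB'
  set K₀ := ⨆ Q ∈ S, volume Q.toSet ^ (a + 1 / q - 1 / p) *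
      orliczAvg A Q (fun x => w' Q x * wpow μ (1 / q) x) *
      orliczAvg B Q (fun x => w Q x * wpow ν (-(1 / p)) x) with hK₀
  -- The summand 1 keeps K nonzero, so that K · ∞ = ∞ when φ has infinite L^p(ν) norm.
  set K : ℝ≥0∞ := 4 * K₀ * C₁ ^ (1 / Real.conjExponent q) * C₂ ^ (1 / q) + 1 with hK
  have hKt : K ≠ ∞ := by
    refine ENNReal.add_ne_top.mpr ⟨ENNReal.mul_ne_top (ENNReal.mul_ne_top
      (ENNReal.mul_ne_top (by simp) hbump.ne) ?_) ?_, by simp⟩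
    · exact (ENNReal.rpow_lt_top_of_nonneg (by positivity) hC₁).ne
    · exact (ENNReal.rpow_lt_top_of_nonneg (by positivity) hC₂).ne
  refine ⟨K.toNNReal, fun φ hφ => ?_⟩
  rw [ENNReal.coe_toNNReal hKt]
  by_cases hfin : ∫⁻ x, (φ x : ℝ≥0∞) ^ p * ENNReal.ofReal (ν x) = ∞
  · have : weightedNorm p ν (fun x => (φ x : ℝ≥0∞)) = ∞ := by
      rw [weightedNorm, hfin, ENNReal.top_rpow_of_pos (by positivity)]
    rw [this, ENNReal.mul_top (by simp [hK])]
    exact le_top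
  have hterm : ∀ Q : Cube n, AEMeasurable (Q.toSet.indicator (fun x =>
      volume Q.toSet ^ a * w' Q x * ⨍⁻ y in Q.toSet, w Q y * φ y ∂volume)) := fun Q =>
    (aemeasurable_indicator_iff Q.measurableSet_toSet).mpr
      (((hw' Q).const_mul _).mul_const _)
  refine weightedNorm_le_of_forall_pairing hμ hq1
    (AEMeasurable.tsum fun Q : S => hterm Q) _ fun g hg hgfin => ?_
  have hμo : AEMeasurable fun x => ENNReal.ofReal (μ x) := hμ.aemeasurable.ennreal_ofReal
  set G : (Fin n → ℝ) → ℝ≥0 := fun x => g x * (μ x).toNNReal ^ (1 / Real.conjExponent q) with hG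
  set v : (Fin n → ℝ) → ℝ≥0 := fun x => φ x * (ν x).toNNReal ^ (1 / p) with hv
  have hGm : AEMeasurable G := hg.mul (hμ.aemeasurable.real_toNNReal.pow_const _)
  have hvm : AEMeasurable v := hφ.mul (hν.aemeasurable.real_toNNReal.pow_const _)
  have hpow : ∀ (s : ℝ), 0 < s → ∀ y z : ℝ≥0,
      (((y * z ^ (1 / s) : ℝ≥0) : ℝ≥0∞)) ^ s = (y : ℝ≥0∞) ^ s * z := by
    intro s hs y z
    rw [ENNReal.coe_mul, ENNReal.mul_rpow_of_nonneg _ _ hs.le,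
      ENNReal.coe_rpow_of_nonneg _ (by positivity), ← ENNReal.rpow_mul,
      one_div_mul_cancel hs.ne', ENNReal.rpow_one]
  have hGint : ∫⁻ x, (G x : ℝ≥0∞) ^ Real.conjExponent q =
      ∫⁻ x, (g x : ℝ≥0∞) ^ Real.conjExponent q * ENNReal.ofReal (μ x) :=
    lintegral_congr fun x => hpow _ hq' _ _
  have hvint : ∫⁻ x, (v x : ℝ≥0∞) ^ p = ∫⁻ x, (φ x : ℝ≥0∞) ^ p * ENNReal.ofReal (ν x) :=
    lintegral_congr fun x => hpow _ hp0 _ _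
  set X := ∫⁻ x, (g x : ℝ≥0∞) ^ Real.conjExponent q * ENNReal.ofReal (μ x) with hX
  set Y := ∫⁻ x, (φ x : ℝ≥0∞) ^ p * ENNReal.ofReal (ν x) with hY
  -- Hölder over the cubes with exponents q' and q, then the embedding for each factor.
  have hsum : ∀ F : Finset (Cube n), (∀ Q ∈ F, Q ∈ S) →
      ∑ Q ∈ F, (volume Q.toSet ^ (1 / Real.conjExponent q) * luxAvg (complementary A) Q G) *
        (volume Q.toSet ^ (1 / p) * luxAvg (complementary B) Q v) ≤
      (C₁ ^ (1 / Real.conjExponent q) * X ^ (1 / Real.conjExponent q)) *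
        (C₂ ^ (1 / q) * Y ^ (1 / p)) := by
    intro F hF
    refine (ENNReal.inner_le_Lp_mul_Lq F _ _ hconj.symm).trans (mul_le_mul' ?_ ?_)
    · rw [← ENNReal.mul_rpow_of_nonneg _ _ (by positivity)]
      refine ENNReal.rpow_le_rpow ?_ (by positivity)
      have := hcarl₁ G hGm (by rwa [hGint]) F hF
      rw [hGint, div_self hq'.ne', ENNReal.rpow_one] at this
      refine le_trans (le_of_eq (Finset.sum_congr rfl fun Q _ => ?_)) this
      rw [ENNReal.mul_rpow_of_nonneg _ _ hq'.le, ← ENNReal.rpow_mul,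
        one_div_mul_cancel hq'.ne']
    · rw [show Y ^ (1 / p) = (Y ^ (q / p)) ^ (1 / q) by
          rw [← ENNReal.rpow_mul]; congr 1; field_simp,
        ← ENNReal.mul_rpow_of_nonneg _ _ (by positivity)]
      refine ENNReal.rpow_le_rpow ?_ (by positivity)
      have := hcarl₂ v hvm (by rwa [hvint]) F hF
      rw [hvint] at this
      refine le_trans (le_of_eq (Finset.sum_congr rfl fun Q _ => ?_)) this
      rw [ENNReal.mul_rpow_of_nonneg _ _ hq0.le, ← ENNReal.rpow_mul]
      congr 2
      ring
  calc ∫⁻ x, (∑' Q : S, Q.1.toSet.indicator (fun x => volume Q.1.toSet ^ a * w' Q x *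
          ⨍⁻ y in Q.1.toSet, w Q y * φ y ∂volume) x) * (g x * ENNReal.ofReal (μ x))
      = ∑' Q : S, ∫⁻ x, Q.1.toSet.indicator (fun x => volume Q.1.toSet ^ a * w' Q x *
          ⨍⁻ y in Q.1.toSet, w Q y * φ y ∂volume) x * (g x * ENNReal.ofReal (μ x)) := by
        have hm : ∀ Q : S, AEMeasurable fun x => Q.1.toSet.indicator (fun x =>
            volume Q.1.toSet ^ a * w' Q x * ⨍⁻ y in Q.1.toSet, w Q y * φ y ∂volume) x *
              (g x * ENNReal.ofReal (μ x)) :=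
          fun Q => (hterm Q).mul (hg.coe_nnreal_ennreal.mul hμo)
        rw [← lintegral_tsum hm]
        simp only [ENNReal.tsum_mul_right]
    _ ≤ ∑' Q : S, 4 * K₀ * ((volume Q.1.toSet ^ (1 / Real.conjExponent q) *
          luxAvg (complementary A) Q G) * (volume Q.1.toSet ^ (1 / p) *
          luxAvg (complementary B) Q v)) := by
        refine ENNReal.tsum_le_tsum fun Q => ?_
        exact lintegral_mul_lintegral_le_of_bump hA hB hp0 hq1 hμ.aemeasurable hν.aemeasurable
          Q.1 (hw Q) (hw' Q) hbump.ne (le_iSup₂_of_le Q.1 Q.2 le_rfl) hφ hg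
    _ ≤ 4 * K₀ * ((C₁ ^ (1 / Real.conjExponent q) * X ^ (1 / Real.conjExponent q)) *
        (C₂ ^ (1 / q) * Y ^ (1 / p))) := by
        rw [ENNReal.tsum_mul_left]
        refine mul_le_mul' le_rfl ?_
        rw [ENNReal.tsum_eq_iSup_sum]
        refine iSup_le fun F => ?_
        have := hsum (F.map ⟨Subtype.val, Subtype.val_injective⟩) fun Q hQ => by
          obtain ⟨R, -, rfl⟩ := Finset.mem_map.mp hQ
          exact R.2
        rwa [Finset.sum_map] at this
    _ = 4 * K₀ * C₁ ^ (1 / Real.conjExponent q) * C₂ ^ (1 / q) * Y ^ (1 / p) *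
          X ^ (1 / Real.conjExponent q) := by ring
    _ ≤ K * weightedNorm p ν (fun x => (φ x : ℝ≥0∞)) * X ^ (1 / Real.conjExponent q) := by
        refine mul_le_mul' (mul_le_mul' ?_ le_rfl) le_rfl
        exact le_self_add

/-! ### Necessity of the conditions with plain averages -/

/-- A single-cube two-weight bound forces the condition with plain averages on that cube. -/
lemma volume_rpow_mul_lpAvg_mul_lpAvg_le {n : ℕ} {p q a : ℝ} (hp : 1 < p) (hq : 0 < q)
    {μ ν : (Fin n → ℝ) → ℝ} (hμ : AEMeasurable μ) (hν : AEMeasurable ν) (Q : Cube n)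
    {w w' : (Fin n → ℝ) → ℝ≥0∞} (hw : AEMeasurable w (volume.restrict Q.toSet))
    (hw' : AEMeasurable w' (volume.restrict Q.toSet)) (hwint : ∫⁻ x in Q.toSet, w x ≠ ∞)
    (K : ℝ≥0)
    (H : ∀ φ : (Fin n → ℝ) → ℝ≥0, AEMeasurable φ →
      weightedNorm q μ (Q.toSet.indicator fun x => volume Q.toSet ^ a * w' x *
        ⨍⁻ y in Q.toSet, w y * φ y ∂volume) ≤ K * weightedNorm p ν (fun x => φ x)) :
    volume Q.toSet ^ (a + 1 / q - 1 / p) *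
      lpAvg q Q (fun x => w' x * wpow μ (1 / q) x) *
      lpAvg (Real.conjExponent p) Q (fun x => w x * wpow ν (-(1 / p)) x) ≤ K := by
  have hp0 : 0 < p := by linarith
  have hconj : p.HolderConjugate (Real.conjExponent p) := Real.HolderConjugate.conjExponent hp
  have hp' : 0 < Real.conjExponent p := hconj.symm.pos
  have hp'1 : 0 < Real.conjExponent p - 1 := hconj.symm.sub_one_pos
  set p' := Real.conjExponent p with hp'def
  set V := volume Q.toSet with hV
  have hV0 : V ≠ 0 := Q.volume_ne_zero
  have hVt : V ≠ ∞ := Q.volume_ne_top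
  set N := lpAvg q Q (fun x => w' x * wpow μ (1 / q) x) with hN
  have hrpow_add : ∀ s t : ℝ, V ^ (s + t) = V ^ s * V ^ t := fun s t =>
    ENNReal.rpow_add _ _ hV0 hVt
  -- The average of wφ is constant on Q, so the norm of a single term factors exactly.
  have hnorm : ∀ φ : (Fin n → ℝ) → ℝ≥0,
      weightedNorm q μ (Q.toSet.indicator fun x => V ^ a * w' x *
        ⨍⁻ y in Q.toSet, w y * φ y ∂volume) =
      V ^ (a + 1 / q) * N * ⨍⁻ y in Q.toSet, w y * φ y ∂volume := by
    intro φ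
    set c := ⨍⁻ y in Q.toSet, w y * φ y ∂volume with hc
    have hm : AEMeasurable (fun x => (w' x * wpow μ (1 / q) x) ^ q) (volume.restrict Q.toSet) :=
      (hw'.mul (hμ.ennreal_ofReal.pow_const _).restrict).pow_const _
    have e : ∫⁻ x, (Q.toSet.indicator (fun x => V ^ a * w' x * c) x) ^ q *
        ENNReal.ofReal (μ x) =
        (V ^ a * c) ^ q * ∫⁻ x in Q.toSet, (w' x * wpow μ (1 / q) x) ^ q := by
      rw [← lintegral_const_mul'' _ hm, ← lintegral_indicator Q.measurableSet_toSet]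
      refine lintegral_congr fun x => ?_
      by_cases hx : x ∈ Q.toSet
      · simp only [indicator_of_mem hx, wpow]
        simp only [ENNReal.mul_rpow_of_nonneg _ _ hq.le]
        rw [← ENNReal.rpow_mul (ENNReal.ofReal (μ x)), one_div_mul_cancel hq.ne',
          ENNReal.rpow_one]
        ring
      · simp [hx, hq]
    rw [weightedNorm, e, ENNReal.mul_rpow_of_nonneg _ _ (by positivity), ← ENNReal.rpow_mul,
      mul_one_div_cancel hq.ne', ENNReal.rpow_one, Q.lintegral_eq_mul_laverage,
      ENNReal.mul_rpow_of_nonneg _ _ (by positivity), hrpow_add, hN, lpAvg]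
    ring
  -- The extremal function: θ^{p-1} = w/ν because (p'-1)(p-1) = 1, and w θ = (w ν^{-1/p})^{p'}.
  set θ : (Fin n → ℝ) → ℝ≥0∞ := fun x => (w x / ENNReal.ofReal (ν x)) ^ (p' - 1) with hθ
  have hθm : AEMeasurable θ (volume.restrict Q.toSet) :=
    (hw.div hν.ennreal_ofReal.restrict).pow_const _
  set ψ : ℕ → (Fin n → ℝ) → ℝ≥0∞ := fun k => Q.toSet.indicator fun x => min (θ x) k with hψ
  have hψm : ∀ k, AEMeasurable (ψ k) := fun k =>
    (aemeasurable_indicator_iff Q.measurableSet_toSet).mpr (hθm.min aemeasurable_const)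
  have hψk : ∀ k x, ψ k x ≤ k := fun k x => indicator_le (fun _ _ => min_le_right _ _) x
  have hψθ : ∀ k x, ψ k x ≤ θ x := fun k x => indicator_le (fun _ _ => min_le_left _ _) x
  have hψtop : ∀ k x, ψ k x ≠ ∞ := fun k x =>
    ne_top_of_le_ne_top (ENNReal.natCast_ne_top k) (hψk k x)
  set d := V ^ (a + 1 / q - 1 / p) * N with hd
  have hbound : ∀ k, d * (⨍⁻ x in Q.toSet, w x * ψ k x ∂volume) ^ (1 / p') ≤ K := by
    intro k
    set Y := ⨍⁻ x in Q.toSet, w x * ψ k x ∂volume with hY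
    have hcoe : ∀ x, (((ψ k x).toNNReal : ℝ≥0) : ℝ≥0∞) = ψ k x := fun x =>
      ENNReal.coe_toNNReal (hψtop k x)
    have h1 := H (fun x => (ψ k x).toNNReal) (hψm k).ennreal_toNNReal
    rw [hnorm] at h1
    simp only [hcoe] at h1
    have hYt : Y ≠ ∞ := by
      have : Y ≤ k * ⨍⁻ x in Q.toSet, w x ∂volume := by
        rw [← Q.laverage_const_mul (ENNReal.natCast_ne_top k)]
        refine laverage_mono_fun fun x => ?_
        rw [mul_comm]
        exact mul_le_mul' (hψk k x) le_rfl
      refine ne_top_of_le_ne_top (ENNReal.mul_ne_top (ENNReal.natCast_ne_top k) ?_) this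
      rw [setLAverage_eq_inv_mul]
      exact ENNReal.mul_ne_top (ENNReal.inv_ne_top.mpr hV0) hwint
    -- From ψ^{p-1} ν ≤ w follows ψ^p ν ≤ w ψ, so the right side of the tested inequality is
    -- controlled by the same average Y as the left. Dividing by |Q|^{1/p} Y^{1/p} leaves d Y^{1/p'}
    -- ≤ K.
    have hle : weightedNorm p ν (ψ k) ≤ V ^ (1 / p) * Y ^ (1 / p) := by
      rw [weightedNorm, ← ENNReal.mul_rpow_of_nonneg _ _ (by positivity),
        ← Q.lintegral_eq_mul_laverage, ← lintegral_indicator Q.measurableSet_toSet]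
      refine ENNReal.rpow_le_rpow (lintegral_mono fun x => ?_) (by positivity)
      by_cases hx : x ∈ Q.toSet
      · rw [indicator_of_mem hx]
        have h2 : ψ k x ^ (p - 1) ≤ w x / ENNReal.ofReal (ν x) := by
          calc ψ k x ^ (p - 1) ≤ θ x ^ (p - 1) :=
                ENNReal.rpow_le_rpow (hψθ k x) (by linarith)
            _ = _ := by
                simp only [hθ]
                rw [← ENNReal.rpow_mul, show (p' - 1) * (p - 1) = 1 by
                  have := hconj.symm.sub_one_mul_conj
                  have := hconj.mul_eq_add
                  linarith, ENNReal.rpow_one]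
        calc ψ k x ^ p * ENNReal.ofReal (ν x)
            = ψ k x * (ψ k x ^ (p - 1) * ENNReal.ofReal (ν x)) := by
              rw [← mul_assoc]
              congr 1
              nth_rewrite 2 [← ENNReal.rpow_one (ψ k x)]
              rw [← ENNReal.rpow_add_of_nonneg _ _ zero_le_one (by linarith), add_sub_cancel]
          _ ≤ ψ k x * w x := by
              refine mul_le_mul' le_rfl ((mul_le_mul' h2 le_rfl).trans ?_)
              rw [mul_comm]
              exact ENNReal.mul_div_le
          _ = w x * ψ k x := mul_comm _ _
      · simp [hψ, hx, hp0]
    have h2 : V ^ (a + 1 / q) * N * Y ≤ K * (V ^ (1 / p) * Y ^ (1 / p)) :=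
      h1.trans (mul_le_mul' le_rfl hle)
    rcases eq_or_ne Y 0 with hY0 | hY0
    · simp [hY0, ENNReal.zero_rpow_of_pos (by positivity : 0 < 1 / p'), -one_div]
    · have hc0 : V ^ (1 / p) * Y ^ (1 / p) ≠ 0 :=
        mul_ne_zero (ENNReal.rpow_pos (pos_iff_ne_zero.mpr hV0) hVt).ne'
          (ENNReal.rpow_pos (pos_iff_ne_zero.mpr hY0) hYt).ne'
      have hct : V ^ (1 / p) * Y ^ (1 / p) ≠ ∞ :=
        ENNReal.mul_ne_top (ENNReal.rpow_ne_top_of_ne_zero hV0 hVt)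
          (ENNReal.rpow_ne_top_of_ne_zero hY0 hYt)
      refine (ENNReal.mul_le_mul_iff_left hc0 hct).mp (le_trans (le_of_eq ?_) h2)
      have e1 : V ^ (a + 1 / q) = V ^ (a + 1 / q - 1 / p) * V ^ (1 / p) := by
        rw [← hrpow_add, sub_add_cancel]
      have e2 : Y = Y ^ (1 / p') * Y ^ (1 / p) := by
        rw [← ENNReal.rpow_add _ _ hY0 hYt, one_div, one_div, hconj.symm.inv_add_inv_eq_one,
          ENNReal.rpow_one]
      rw [e1]
      nth_rewrite 3 [e2]
      rw [hd]
      ring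
  have hlim : Tendsto (fun k => ⨍⁻ x in Q.toSet, w x * ψ k x ∂volume) atTop
      (nhds (⨍⁻ x in Q.toSet, (w x * wpow ν (-(1 / p)) x) ^ p' ∂volume)) := by
    simp only [setLAverage_eq_inv_mul]
    refine ENNReal.Tendsto.const_mul ?_ (Or.inr (ENNReal.inv_ne_top.mpr hV0))
    refine lintegral_tendsto_of_tendsto_of_monotone (fun k => hw.mul (hψm k).restrict)
      (ae_of_all _ fun x k l hkl => ?_)
      ((ae_restrict_iff' Q.measurableSet_toSet).mpr (ae_of_all _ fun x hx => ?_))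
    · refine mul_le_mul' le_rfl (indicator_le_indicator' fun _ => ?_)
      exact min_le_min_left _ (by exact_mod_cast hkl)
    · have hψx : ∀ k, ψ k x = min (θ x) k := fun k => indicator_of_mem hx _
      simp only [hψx]
      -- The identity also holds where ν = 0: both sides are then 0 if w = 0 and ∞ otherwise.
      have hval : (w x * wpow ν (-(1 / p)) x) ^ p' = w x * θ x := by
        have hpp : 1 / p * p' = p' - 1 := by
          have := hconj.mul_eq_add
          field_simp
          linarith
        simp only [wpow, hθ]
        rw [ENNReal.mul_rpow_of_nonneg _ _ hp'.le, ← ENNReal.rpow_mul, neg_mul, hpp,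
          ENNReal.div_rpow_of_nonneg _ _ hp'1.le, div_eq_mul_inv, ← ENNReal.rpow_neg, ← mul_assoc]
        congr 1
        nth_rewrite 2 [← ENNReal.rpow_one (w x)]
        rw [← ENNReal.rpow_add_of_nonneg _ _ zero_le_one hp'1.le, add_sub_cancel]
      rw [hval]
      rcases eq_or_ne (w x) 0 with h0 | h0
      · simp [h0]
      · rcases eq_or_ne (θ x) 0 with h1 | h1
        · simp [h1]
        · refine ENNReal.Tendsto.const_mul ?_ (Or.inl h1)
          simpa using (tendsto_const_nhds (x := θ x)).min ENNReal.tendsto_nat_nhds_top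
  -- The factor d may be ∞, and multiplication by it need not commute with the limit; so the limit
  -- is taken in Y^{1/p'} ≤ K/d.
  rcases eq_or_ne d 0 with hd0 | hd0
  · simp [hd0]
  · rw [mul_comm, ← ENNReal.le_div_iff_mul_le (Or.inl hd0) (Or.inr ENNReal.coe_ne_top)]
    refine le_of_tendsto (hlim.ennrpow_const (1 / p')) (Eventually.of_forall fun k => ?_)
    rw [ENNReal.le_div_iff_mul_le (Or.inl hd0) (Or.inr ENNReal.coe_ne_top), mul_comm]
    exact hbound k

/-! ### The oscillation of `b` -/

section Osc

variable {n : ℕ} {𝕜 : Type*} [RCLike 𝕜]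

lemma MemLmLoc.memLp_restrict_cube {m : ℕ} {b : (Fin n → ℝ) → 𝕜} (hb : MemLmLoc m b)
    (Q : Cube n) : MemLp b m (volume.restrict Q.toSet) :=
  (hb _ isCompact_Icc).mono_measure (Measure.restrict_mono_set _ Q.subset_Icc)

lemma MemLmLoc.aemeasurable_osc {m : ℕ} {b : (Fin n → ℝ) → 𝕜} (hb : MemLmLoc m b)
    (Q : Cube n) : AEMeasurable (osc b m Q) (volume.restrict Q.toSet) :=
  (((hb.memLp_restrict_cube Q).1.sub aestronglyMeasurable_const).enorm).pow_const m

lemma MemLmLoc.lintegral_osc_ne_top {m : ℕ} (hm : 0 < m) {b : (Fin n → ℝ) → 𝕜}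
    (hb : MemLmLoc m b) (Q : Cube n) : ∫⁻ x in Q.toSet, osc b m Q x ≠ ∞ := by
  have : IsFiniteMeasure (volume.restrict Q.toSet) :=
    ⟨by simpa using Q.volume_ne_top.lt_top⟩
  have h := (hb.memLp_restrict_cube Q).sub (memLp_const (⨍ y in Q.toSet, b y))
  have h2 := lintegral_rpow_enorm_lt_top_of_eLpNorm_lt_top (by simpa using hm.ne') (by simp) h.2
  simp only [ENNReal.toReal_natCast, ENNReal.rpow_natCast] at h2
  exact h2.ne

/-- The explicit factors 1, here and in `sparseTermStar_eq`, exhibit both operators as instances of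
the general (w, w') form. -/
lemma sparseTerm_eq (α : ℝ) (b : (Fin n → ℝ) → 𝕜) (m : ℕ) (Q : Cube n)
    (f : (Fin n → ℝ) → 𝕜) :
    sparseTerm α b m Q f = Q.toSet.indicator fun _ => volume Q.toSet ^ (α / n) * 1 *
      ⨍⁻ y in Q.toSet, osc b m Q y * ‖f y‖₊ ∂volume := by
  simp only [sparseTerm, mul_one, enorm_eq_nnnorm]

lemma sparseTermStar_eq (α : ℝ) (b : (Fin n → ℝ) → 𝕜) (m : ℕ) (Q : Cube n)
    (f : (Fin n → ℝ) → 𝕜) :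
    sparseTermStar α b m Q f = Q.toSet.indicator fun x => volume Q.toSet ^ (α / n) *
      osc b m Q x * ⨍⁻ y in Q.toSet, 1 * ‖f y‖₊ ∂volume := by
  simp only [sparseTermStar, one_mul, enorm_eq_nnnorm]

lemma sparseSup_le_sparseSum (S : Set (Cube n)) (α : ℝ) (b : (Fin n → ℝ) → 𝕜) (m : ℕ)
    (f : (Fin n → ℝ) → 𝕜) (x : Fin n → ℝ) : sparseSup S α b m f x ≤ sparseSum S α b m f x :=
  iSup₂_le fun Q hQ => ENNReal.le_tsum (f := fun R : S => sparseTerm α b m R f x) ⟨Q, hQ⟩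

lemma sparseSupStar_le_sparseSumStar (S : Set (Cube n)) (α : ℝ) (b : (Fin n → ℝ) → 𝕜) (m : ℕ)
    (f : (Fin n → ℝ) → 𝕜) (x : Fin n → ℝ) :
    sparseSupStar S α b m f x ≤ sparseSumStar S α b m f x :=
  iSup₂_le fun Q hQ => ENNReal.le_tsum (f := fun R : S => sparseTermStar α b m R f x) ⟨Q, hQ⟩

lemma BothBounded.of_le {p q : ℝ} (hq : 0 ≤ q) {μ ν : (Fin n → ℝ) → ℝ}
    {T T' U U' : ((Fin n → ℝ) → 𝕜) → (Fin n → ℝ) → ℝ≥0∞} (h : BothBounded p q μ ν U U')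
    (hT : ∀ f x, T f x ≤ U f x) (hT' : ∀ f x, T' f x ≤ U' f x) : BothBounded p q μ ν T T' := by
  obtain ⟨K, hK⟩ := h
  exact ⟨K, fun f hf => (add_le_add (weightedNorm_mono hq μ (hT f))
    (weightedNorm_mono hq μ (hT' f))).trans (hK f hf)⟩

lemma enorm_ofReal_nnreal (y : ℝ≥0) : ‖((y : ℝ) : 𝕜)‖ₑ = y := by
  rw [← ofReal_norm, RCLike.norm_ofReal, abs_of_nonneg (NNReal.coe_nonneg y)]
  exact ENNReal.ofReal_coe_nnreal

/-- Boundedness of operators dominating each term of the sparse operators forces the conditions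
with plain averages. -/
lemma BothBounded.iSup_lpAvg_lt_top {p q α : ℝ} (hp : 1 < p) (hq : 0 < q) {m : ℕ} (hm : 0 < m)
    {b : (Fin n → ℝ) → 𝕜} (hb : MemLmLoc m b) {S : Set (Cube n)} {μ ν : (Fin n → ℝ) → ℝ}
    (hμ : IsWeight μ) (hν : IsWeight ν) {T T' : ((Fin n → ℝ) → 𝕜) → (Fin n → ℝ) → ℝ≥0∞}
    (h : BothBounded p q μ ν T T')
    (hT : ∀ Q ∈ S, ∀ f x, sparseTerm α b m Q f x ≤ T f x)
    (hT' : ∀ Q ∈ S, ∀ f x, sparseTermStar α b m Q f x ≤ T' f x) :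
    (⨆ Q ∈ S, volume Q.toSet ^ (α / n + 1 / q - 1 / p) * lpAvg q Q (wpow μ (1 / q)) *
        lpAvg (Real.conjExponent p) Q (fun x => osc b m Q x * wpow ν (-(1 / p)) x)) +
      (⨆ Q ∈ S, volume Q.toSet ^ (α / n + 1 / q - 1 / p) *
        lpAvg q Q (fun x => osc b m Q x * wpow μ (1 / q) x) *
        lpAvg (Real.conjExponent p) Q (wpow ν (-(1 / p)))) < ∞ := by
  obtain ⟨K, hK⟩ := h
  have hf : ∀ φ : (Fin n → ℝ) → ℝ≥0, AEMeasurable φ →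
      AEStronglyMeasurable (fun x => ((φ x : ℝ) : 𝕜)) volume := fun φ hφ =>
    RCLike.continuous_ofReal.comp_aestronglyMeasurable hφ.coe_nnreal_real.aestronglyMeasurable
  refine ENNReal.add_lt_top.mpr ⟨lt_of_le_of_lt (iSup₂_le fun Q hQ => ?_)
    (ENNReal.coe_lt_top (r := K)), lt_of_le_of_lt (iSup₂_le fun Q hQ => ?_)
    (ENNReal.coe_lt_top (r := K))⟩
  · have := volume_rpow_mul_lpAvg_mul_lpAvg_le (a := α / n) hp hq hμ.aemeasurable
      hν.aemeasurable Q (w' := fun _ => 1) (hb.aemeasurable_osc Q) aemeasurable_const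
      (hb.lintegral_osc_ne_top hm Q) K fun φ hφ => ?_
    · simpa only [one_mul] using this
    · have h1 := le_self_add.trans (hK _ (hf φ hφ))
      simp only [enorm_ofReal_nnreal] at h1
      refine le_trans (weightedNorm_mono hq.le μ fun x => ?_) h1
      refine le_trans (le_of_eq ?_) (hT Q hQ _ x)
      simp only [sparseTerm, mul_one, enorm_ofReal_nnreal]
  · have := volume_rpow_mul_lpAvg_mul_lpAvg_le (a := α / n) hp hq hμ.aemeasurable
      hν.aemeasurable Q (w := fun _ => 1) aemeasurable_const (hb.aemeasurable_osc Q)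
      (by simpa using Q.volume_ne_top) K fun φ hφ => ?_
    · simpa only [one_mul] using this
    · have h1 := le_add_self.trans (hK _ (hf φ hφ))
      simp only [enorm_ofReal_nnreal] at h1
      refine le_trans (weightedNorm_mono hq.le μ fun x => ?_) h1
      refine le_trans (le_of_eq ?_) (hT' Q hQ _ x)
      simp only [sparseTermStar, one_mul, enorm_ofReal_nnreal]

/-- The Orlicz bump conditions imply the boundedness of the sparse operators given by sums. -/
lemma bothBounded_sparseSum {p q α : ℝ} (hp : 1 < p) (hpq : p ≤ q) {m : ℕ}
    {b : (Fin n → ℝ) → 𝕜} (hb : MemLmLoc m b) {S : Set (Cube n)} (hS : IsSparse S)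
    {μ ν : (Fin n → ℝ) → ℝ} (hμ : IsWeight μ) (hν : IsWeight ν) {A B C D : ℝ≥0 → ℝ≥0}
    (hA : IsYoung A) (hB : IsYoung B) (hC : IsYoung C) (hD : IsYoung D)
    (hA' : MemB (Real.conjExponent q) (complementary A))
    (hC' : MemB (Real.conjExponent q) (complementary C))
    (hB' : MemBpq p q (complementary B)) (hD' : MemBpq p q (complementary D))
    (hbump₁ : ⨆ Q ∈ S, volume Q.toSet ^ (α / n + 1 / q - 1 / p) *
      orliczAvg A Q (wpow μ (1 / q)) *
      orliczAvg B Q (fun x => osc b m Q x * wpow ν (-(1 / p)) x) < ∞)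
    (hbump₂ : ⨆ Q ∈ S, volume Q.toSet ^ (α / n + 1 / q - 1 / p) *
      orliczAvg C Q (fun x => osc b m Q x * wpow μ (1 / q) x) *
      orliczAvg D Q (wpow ν (-(1 / p))) < ∞) :
    BothBounded p q μ ν (sparseSum S α b m) (sparseSumStar S α b m) := by
  obtain ⟨K₁, hK₁⟩ := exists_weightedNorm_tsum_le (a := α / n) hS hA hB hp hpq hA' hB' hμ hν
    (w := fun Q => osc b m Q) (w' := fun _ _ => 1) hb.aemeasurable_osc
    (fun _ => aemeasurable_const) (by simpa only [one_mul] using hbump₁)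
  obtain ⟨K₂, hK₂⟩ := exists_weightedNorm_tsum_le (a := α / n) hS hC hD hp hpq hC' hD' hμ hν
    (w := fun _ _ => 1) (w' := fun Q => osc b m Q) (fun _ => aemeasurable_const)
    hb.aemeasurable_osc (by simpa only [one_mul] using hbump₂)
  refine ⟨K₁ + K₂, fun f hf => ?_⟩
  rw [ENNReal.coe_add, add_mul]
  refine add_le_add ?_ ?_
  · refine le_trans (weightedNorm_mono (by linarith) μ fun x => ?_)
      (hK₁ (fun x => ‖f x‖₊) hf.nnnorm.aemeasurable)
    simp only [sparseSum, sparseTerm_eq, le_refl]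
  · refine le_trans (weightedNorm_mono (by linarith) μ fun x => ?_)
      (hK₂ (fun x => ‖f x‖₊) hf.nnnorm.aemeasurable)
    simp only [sparseSumStar, sparseTermStar_eq, le_refl]

end Osc

end SparseBump

/-! ### The two-weight theorem. -/

theorem theorem1p1 {n : ℕ} {𝕜 : Type*} [RCLike 𝕜] {p q α : ℝ}
    (hp : 1 < p) (hpq : p ≤ q) (hα : 0 < α) (hαn : α < n)
    {m : ℕ} (hm : 0 < m) {b : (Fin n → ℝ) → 𝕜} (hb : SparseBump.MemLmLoc m b)
    {S : Set (SparseBump.Cube n)} (hS : SparseBump.IsSparse S)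
    {μ ν : (Fin n → ℝ) → ℝ} (hμ : SparseBump.IsWeight μ) (hν : SparseBump.IsWeight ν) :
    -- sufficiency of the Orlicz bump conditions
    (∀ A B C D : ℝ≥0 → ℝ≥0,
      SparseBump.IsYoung A → SparseBump.IsYoung B →
      SparseBump.IsYoung C → SparseBump.IsYoung D →
      SparseBump.MemB (Real.conjExponent q) (SparseBump.complementary A) →
      SparseBump.MemB (Real.conjExponent q) (SparseBump.complementary C) →
      SparseBump.MemBpq p q (SparseBump.complementary B) →
      SparseBump.MemBpq p q (SparseBump.complementary D) →
      (⨆ Q ∈ S, volume Q.toSet ^ (α / n + 1 / q - 1 / p) *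
          SparseBump.orliczAvg A Q (SparseBump.wpow μ (1 / q)) *
          SparseBump.orliczAvg B Q
            (fun x => SparseBump.osc b m Q x * SparseBump.wpow ν (-(1 / p)) x)) +
        (⨆ Q ∈ S, volume Q.toSet ^ (α / n + 1 / q - 1 / p) *
          SparseBump.orliczAvg C Q
            (fun x => SparseBump.osc b m Q x * SparseBump.wpow μ (1 / q) x) *
          SparseBump.orliczAvg D Q (SparseBump.wpow ν (-(1 / p)))) < ∞ →
      SparseBump.BothBounded p q μ ν
          (SparseBump.sparseSup S α b m) (SparseBump.sparseSupStar S α b m) ∧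
        SparseBump.BothBounded p q μ ν
          (SparseBump.sparseSum S α b m) (SparseBump.sparseSumStar S α b m)) ∧
    -- necessity of the conditions with plain averages
    ((SparseBump.BothBounded p q μ ν
          (SparseBump.sparseSup S α b m) (SparseBump.sparseSupStar S α b m) ∨
        SparseBump.BothBounded p q μ ν
          (SparseBump.sparseSum S α b m) (SparseBump.sparseSumStar S α b m)) →
      (⨆ Q ∈ S, volume Q.toSet ^ (α / n + 1 / q - 1 / p) *
          SparseBump.lpAvg q Q (SparseBump.wpow μ (1 / q)) *
          SparseBump.lpAvg (Real.conjExponent p) Q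
            (fun x => SparseBump.osc b m Q x * SparseBump.wpow ν (-(1 / p)) x)) +
        (⨆ Q ∈ S, volume Q.toSet ^ (α / n + 1 / q - 1 / p) *
          SparseBump.lpAvg q Q
            (fun x => SparseBump.osc b m Q x * SparseBump.wpow μ (1 / q) x) *
          SparseBump.lpAvg (Real.conjExponent p) Q (SparseBump.wpow ν (-(1 / p)))) < ∞) := by
  have hq : 0 < q := by linarith
  refine ⟨fun A B C D hA hB hC hD hA' hC' hB' hD' hbump => ?_, fun h => ?_⟩
  · rw [ENNReal.add_lt_top] at hbump
    have h := SparseBump.bothBounded_sparseSum hp hpq hb hS hμ hν hA hB hC hD hA' hC' hB' hD'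
      hbump.1 hbump.2
    exact ⟨h.of_le hq.le (SparseBump.sparseSup_le_sparseSum S α b m)
      (SparseBump.sparseSupStar_le_sparseSumStar S α b m), h⟩
  · rcases h with h | h
    · exact h.iSup_lpAvg_lt_top hp hq hm hb hμ hν
        (fun Q hQ f x => le_iSup₂_of_le Q hQ le_rfl) (fun Q hQ f x => le_iSup₂_of_le Q hQ le_rfl)
    · exact h.iSup_lpAvg_lt_top hp hq hm hb hμ hν
        (fun Q hQ f x => ENNReal.le_tsum
          (f := fun R : S => SparseBump.sparseTerm α b m R f x) ⟨Q, hQ⟩)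
        (fun Q hQ f x => ENNReal.le_tsum
          (f := fun R : S => SparseBump.sparseTermStar α b m R f x) ⟨Q, hQ⟩)
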